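/- Let $\mathcal H_A=\mathcal H_{A'}\otimes\mathcal H_{A''}$ and $\mathcal H_B$ be finite-dimensional complex Hilbert spaces with $\mathcal H_{A''}=\mathbb C^2$. Let $\tau$ be a density matrix on $\mathcal H_A\otimes\mathcal H_B$ and let $U_1,U_2,U_3,U_4$ be unitary operators on $\mathcal H_A$. Suppose that $(\tau,(U_i))$ is an (exact, two-dimensional) superdense coding protocol, that is, there is a POVM $\{M_1,M_2,M_3,M_4\}$ on $\mathcal H_{A''}\otimes\mathcal H_B$ with $\mathrm{Tr}(M_i\rho_i)=1$ for every $i$, where $\rho_i$ is the reduced density matrix of $(U_i\otimes \mathbb 1)\tau(U_i\otimes \mathbb 1)^*$ on $\mathcal H_{A''}\otimes\mathcal H_B$. Then there exist 1. unitary operators $V$ on $\mathcal H_{A'}\otimes\mathcal H_{A''}$ and $C_1,\dots,C_4$ on $\mathcal H_{A'}$, 2. an isometry $W:\mathcal H_B\to\mathcal H_{B'}\otimes\mathcal H_{B''}$, where $\mathcal H_{B'}$ is a finite-dimensional Hilbert space and $\mathcal H_{B''}=\mathbb C^2$, 3. a density matrix $\rho$ on $\mathcal H_{A'}\otimes\mathcal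 H_{B'}$, 4. a finite family of pairwise orthogonal projectors $\{P_r\}$ on $\mathcal H_{A'}$ that sum to the identity, and 5. a family of $2\times2$ unitary matrices $\{S_r\}$, such that, with $\tau' := (V\otimes W)\,\tau\,(V\otimes W)^*$, $$\tau'=\rho^{A'B'}\otimes|\mathrm{EPR}\rangle\langle\mathrm{EPR}|^{A''B''},\qquad |\mathrm{EPR}\rangle=\tfrac1{\sqrt2}\big(|00\rangle+|11\rangle\big),$$ and for every $i\in\{1,2,3,4\}$ $$(C_i^*\otimes \mathbb 1)\,U_iV^* \;=_{\tau'}\; \sum_r P_r\otimes S_r\sigma_iS_r^*.$$ Here $\sigma_1=\mathbb 1$, $\sigma_2=\mathrm Z$, $\sigma_3=\mathrm X$, $\sigma_4=\mathrm Y$ are the Pauli matrices, and $X=_{\tau'}Y$, for operators $X,Y$ on $\mathcal H_{A'}\otimes\mathcal H_{A''}$, means that $(X\otimes \mathbb 1)\,\tau'\,(X\otimes \mathbb 1)^*=(Y\otimes \mathbb 1)\,\tau'\,(Y\otimes \mathbb 1)^*$, the identity acting on $\mathcal H_{B'}\otimes\mathcal H_{B''}$. -/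

import Mathlib

open scoped Matrix Kronecker ComplexOrder

/-!
Finite-dimensional Hilbert spaces are `ℂ^ι` for finite index types `ι`; operators are matrices, and
`ℂ^α ⊗ ℂ^β` is `ℂ^(α × β)`. Alice's space is `ℂ^(α × Fin 2)` (register `A'` indexed by `α`, the
qubit `A''` by `Fin 2`), Bob's space is `ℂ^β`.
-/

namespace SuperdenseCoding

/-- A density matrix: positive semidefinite of trace one. -/
structure IsDensityMatrix {ι : Type*} [Fintype ι] (ρ : Matrix ι ι ℂ) : Prop where
  posSemidef : ρ.PosSemidef
  trace_eq_one : ρ.trace = 1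

/-- A POVM: positive semidefinite operators summing to the identity. -/
structure IsPOVM {κ ι : Type*} [Fintype κ] [DecidableEq ι] (M : κ → Matrix ι ι ℂ) : Prop where
  posSemidef : ∀ k, (M k).PosSemidef
  sum_eq_one : ∑ k, M k = 1

/-- A projective measurement: pairwise orthogonal (Hermitian) projectors summing to the identity. -/
structure IsProjectiveMeasurement {κ ι : Type*} [Fintype κ] [Fintype ι] [DecidableEq ι]
    (P : κ → Matrix ι ι ℂ) : Prop where
  isStarProjection : ∀ k, IsStarProjection (P k)
  orthogonal : ∀ k l, k ≠ l → P k * P l = 0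
  sum_eq_one : ∑ k, P k = 1

/-- The partial trace over `A'` of an operator on `(A' ⊗ A'') ⊗ B`, an operator on `A'' ⊗ B`. -/
def partialTraceA' {α δ β : Type*} [Fintype α] (X : Matrix ((α × δ) × β) ((α × δ) × β) ℂ) :
    Matrix (δ × β) (δ × β) ℂ :=
  Matrix.of fun x y => ∑ a, X ((a, x.1), x.2) ((a, y.1), y.2)

/-- The reduced state on `A'' ⊗ B` held by Bob after Alice has applied `U` to her share of `τ` and
has sent the register `A''`. -/
def receivedState {α δ β : Type*} [Fintype α] [Fintype δ] [Fintype β] [DecidableEq β]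
    (τ : Matrix ((α × δ) × β) ((α × δ) × β) ℂ) (U : Matrix (α × δ) (α × δ) ℂ) :
    Matrix (δ × β) (δ × β) ℂ :=
  partialTraceA' ((U ⊗ₖ (1 : Matrix β β ℂ)) * τ * (U ⊗ₖ (1 : Matrix β β ℂ))ᴴ)

/-- `(τ, (U_i))` is an (exact, two-dimensional) superdense coding protocol: `τ` is a shared state,
the encoding operators `U_i` are unitary, and some POVM on `A'' ⊗ B` identifies each of the four
messages with probability (at least) one. -/
structure IsSuperdenseCodingProtocol {α β : Type*} [Fintype α] [DecidableEq α] [Fintype β]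
    [DecidableEq β] (τ : Matrix ((α × Fin 2) × β) ((α × Fin 2) × β) ℂ)
    (U : Fin 4 → Matrix (α × Fin 2) (α × Fin 2) ℂ) : Prop where
  isDensityMatrix : IsDensityMatrix τ
  unitary : ∀ i, U i ∈ Matrix.unitaryGroup (α × Fin 2) ℂ
  exists_decoding : ∃ M : Fin 4 → Matrix (Fin 2 × β) (Fin 2 × β) ℂ,
    IsPOVM M ∧ ∀ i, 1 ≤ (M i * receivedState τ (U i)).trace.re

/-- The vector `(|00⟩ + |11⟩) / √2`. -/
noncomputable def eprVec : Fin 2 × Fin 2 → ℂ :=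
  fun x => if x.1 = x.2 then 1 / (Real.sqrt 2 : ℂ) else 0

/-- The density matrix `|EPR⟩⟨EPR|`. -/
noncomputable def epr : Matrix (Fin 2 × Fin 2) (Fin 2 × Fin 2) ℂ :=
  Matrix.vecMulVec eprVec (star eprVec)

/-- The Pauli matrices in the order `1, Z, X, Y`. -/
def pauli : Fin 4 → Matrix (Fin 2) (Fin 2) ℂ :=
  ![1, !![1, 0; 0, -1], !![0, 1; 1, 0], !![0, -Complex.I; Complex.I, 0]]

/-- `ρ^{A'B'} ⊗ ω^{A''B''}` as an operator on `(A' ⊗ A'') ⊗ (B' ⊗ B'')`. -/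
def tensorAcross {α β γ δ : Type*} (ρ : Matrix (α × β) (α × β) ℂ) (ω : Matrix (γ × δ) (γ × δ) ℂ) :
    Matrix ((α × γ) × (β × δ)) ((α × γ) × (β × δ)) ℂ :=
  (ρ ⊗ₖ ω).submatrix (Equiv.prodProdProdComm α γ β δ) (Equiv.prodProdProdComm α γ β δ)

/-- `X =_ρ Y`: the operators `X` and `Y` act in the same way on the state `ρ`. -/
def EqOnState {ι : Type*} [Fintype ι] (ρ X Y : Matrix ι ι ℂ) : Prop :=
  X * ρ * Xᴴ = Y * ρ * Yᴴ

end SuperdenseCoding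

/-! Write `τ = ΨΨᴴ` and let `N i` be the amplitudes of A''B against A' and the purifying system
after `U i` has been applied. Perfect decoding makes the column spaces of the four `N i` orthogonal
(`conjTranspose_mul_eq_zero_of_discriminated`), while Bob's own marginal `ω` does not depend on `i`.

Let d be the rank of `ω`. A marginal of rank d forces each `N i` to have rank at least d/2, and four
orthogonal ranges in ℂ² ⊗ ℂ^d leave room for exactly d/2 each. A trace identity for the inverse of
`ω` on its support then shows that isometries onto these ranges, reshaped by `flat`, are unitary up
to a factor √2 (`two_smul_conjTranspose_flat_mul_flat`). So the support is ℂ^k ⊗ ℂ², and the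
messages become four unitaries `u i` with `u 0 = 1` and `(u i)ᴴ * u j` of zero qubit trace for i ≠ j
(`exists_unitaries_of_orthogonal`).

For i ≠ 0 this gives `u i = ∑ₛ Xₛ ⊗ σₛ`. If `u i` is unitary, the products `Xₐ * (X_b)ᴴ` are
commuting Hermitian matrices with joint eigenvalues nₐ n_b, where n is a real unit vector.
Orthogonality makes the families of `u 1` and `u 2` commute with each other. In a common eigenbasis
their vectors n_r and m_r are orthogonal, and `u 3` can only point along n_r × m_r. Each such frame
is a rotation by some `S r` of Z, X, Y (`exists_common_pauli_form`).

For Alice, `T i = U i * (U 0)ᴴ` sends `φ r ⊗ 1` to `χ i r ⊗ S r σᵢ (S r)ᴴ`. Comparison of Gram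
matrices shows that amplitudes with inequivalent frames are orthogonal, so projectors separate them,
and that a unitary `C i` on A' carries `φ r` to `χ i r` up to a scalar
(`exists_projectiveMeasurement_of_unitary`). Finally `V = U 0`, and the two operators already agree
on the purification. -/

namespace SuperdenseCoding

/-! ### Linear algebra: isometries, Gram matrices, separating projectors, simultaneous
diagonalization. -/

section Tools

variable {m c ι : Type*} [Fintype m] [Fintype c] [DecidableEq c]

/-- A matrix factors through an isometry onto its column space. -/
lemma exists_isometry_factor (N : Matrix m c ℂ) :
    ∃ (k : ℕ) (A : Matrix m (Fin k) ℂ) (Z : Matrix c (Fin k) ℂ),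
      Aᴴ * A = 1 ∧ A * Aᴴ * N = N ∧ A = N * Z := by
  let S := LinearMap.range N.toEuclideanLin
  let b := stdOrthonormalBasis ℂ S
  let A : Matrix m (Fin (Module.finrank ℂ S)) ℂ := Matrix.of fun x r => (b r : EuclideanSpace ℂ m) x
  have hz : ∀ r, ∃ z : EuclideanSpace ℂ c, N.toEuclideanLin z = b r := fun r => (b r).2
  choose z hz using hz
  have hAA : Aᴴ * A = 1 := by
    ext r s
    have := b.inner_eq_ite r s
    rw [Submodule.coe_inner, EuclideanSpace.inner_eq_star_dotProduct] at this
    rw [Matrix.one_apply, ← this, Matrix.mul_apply, dotProduct]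
    exact Finset.sum_congr rfl fun x _ => by simp [A, mul_comm]
  have hAZ : A = N * Matrix.of fun y r => z r y := by
    ext x r
    have := congrArg (fun v : EuclideanSpace ℂ m => v x) (hz r)
    simpa [A, Matrix.mul_apply, Matrix.mulVec, dotProduct] using this.symm
  refine ⟨_, A, _, hAA, ?_, hAZ⟩
  have hrange : ∀ y : EuclideanSpace ℂ c, ∃ v, N.toEuclideanLin y = A.toEuclideanLin v := by
    intro y
    let w : S := ⟨N.toEuclideanLin y, LinearMap.mem_range_self _ y⟩
    refine ⟨b.repr w, (congrArg Subtype.val (b.sum_repr w)).symm.trans ?_⟩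
    generalize b.repr w = v
    ext x
    simp only [A, Submodule.coe_sum, Submodule.coe_smul, WithLp.ofLp_sum, WithLp.ofLp_smul,
      Finset.sum_apply, Pi.smul_apply, smul_eq_mul, Matrix.ofLp_toLpLin, Matrix.toLin'_apply,
      Matrix.mulVec, dotProduct, Matrix.of_apply]
    exact Finset.sum_congr rfl fun r _ => mul_comm _ _
  ext x y
  obtain ⟨v, hv⟩ := hrange (EuclideanSpace.single y 1)
  have hcol : N *ᵥ (Pi.single y 1) = A *ᵥ v.ofLp := by
    simpa using congrArg WithLp.ofLp hv
  have : (A * Aᴴ * N) *ᵥ (Pi.single y 1) = N *ᵥ (Pi.single y 1) := by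
    rw [← Matrix.mulVec_mulVec, hcol, Matrix.mulVec_mulVec, Matrix.mul_assoc, hAA, Matrix.mul_one]
  simpa using congrFun this x

variable [DecidableEq m]

/-- The isometry from the range of `A` that undoes `A` and applies `Y` extends to the whole space.
-/
lemma exists_unitary_mul_eq_of_isometry {k : ℕ} (A Y : Matrix m (Fin k) ℂ) (hA : Aᴴ * A = 1)
    (hY : Yᴴ * Y = 1) : ∃ C ∈ Matrix.unitaryGroup m ℂ, C * A = Y := by
  have key : ∀ X : Matrix m (Fin k) ℂ, Xᴴ * X = 1 → ∀ v, ‖X.toEuclideanLin v‖ = ‖v‖ := by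
    intro X hX v
    have : inner ℂ (X.toEuclideanLin v) (X.toEuclideanLin v) = inner ℂ v v := by
      rw [← LinearMap.adjoint_inner_right, ← Matrix.toEuclideanLin_conjTranspose_eq_adjoint]
      congr 1
      ext r
      simp [Matrix.mulVec_mulVec, hX]
    rw [inner_self_eq_norm_sq_to_K, inner_self_eq_norm_sq_to_K] at this
    have h2 : ‖X.toEuclideanLin v‖ ^ 2 = ‖v‖ ^ 2 := by exact_mod_cast this
    exact (sq_eq_sq₀ (norm_nonneg _) (norm_nonneg _)).1 h2
  let fA : EuclideanSpace ℂ (Fin k) →ₗᵢ[ℂ] EuclideanSpace ℂ m := ⟨A.toEuclideanLin, key A hA⟩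
  let fY : EuclideanSpace ℂ (Fin k) →ₗᵢ[ℂ] EuclideanSpace ℂ m := ⟨Y.toEuclideanLin, key Y hY⟩
  let L := (fY.comp fA.equivRange.symm.toLinearIsometry).extend
  have hL : ∀ v, L (fA v) = fY v := by
    intro v
    have := (fY.comp fA.equivRange.symm.toLinearIsometry).extend_apply (fA.equivRange v)
    simpa [L] using this
  refine ⟨Matrix.toEuclideanLin.symm L.toLinearMap, ?_, ?_⟩
  · rw [Matrix.mem_unitaryGroup_iff']
    set C := Matrix.toEuclideanLin.symm L.toLinearMap
    have hC : C.toEuclideanLin = L.toLinearMap := by simp [C]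
    apply Matrix.toEuclideanLin.injective
    ext v x
    rw [Matrix.star_eq_conjTranspose]
    have : Cᴴ.toEuclideanLin (C.toEuclideanLin v) = v := by
      rw [Matrix.toEuclideanLin_conjTranspose_eq_adjoint]
      apply ext_inner_left ℂ
      intro w
      rw [LinearMap.adjoint_inner_right, hC]
      exact L.inner_map_map w v
    have := congrArg (fun v : EuclideanSpace ℂ m => v x) this
    simpa [Matrix.mulVec_mulVec] using this
  · apply Matrix.toEuclideanLin.injective
    ext v x
    have := congrArg (fun v : EuclideanSpace ℂ m => v x) (hL v)
    set C := Matrix.toEuclideanLin.symm L.toLinearMap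
    have hC : C.toEuclideanLin = L.toLinearMap := by simp [C]
    have h3 : C.toEuclideanLin (A.toEuclideanLin v) = Y.toEuclideanLin v := by
      rw [hC]; exact hL v
    have := congrArg (fun v : EuclideanSpace ℂ m => v x) h3
    simpa [Matrix.mulVec_mulVec] using this

/-- Matrices with the same Gram matrix differ by a unitary. -/
lemma exists_unitary_mul_eq (X Y : Matrix m c ℂ) (h : Xᴴ * X = Yᴴ * Y) :
    ∃ C ∈ Matrix.unitaryGroup m ℂ, C * X = Y := by
  obtain ⟨k, A, Z, hA, hAX, hZ⟩ := exists_isometry_factor X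
  have hY : (Y * Z)ᴴ * (Y * Z) = 1 := by
    rw [Matrix.conjTranspose_mul, Matrix.mul_assoc, ← Matrix.mul_assoc Yᴴ, ← h, ← hA, hZ,
      Matrix.conjTranspose_mul]
    simp only [Matrix.mul_assoc]
  obtain ⟨C, hC, hCA⟩ := exists_unitary_mul_eq_of_isometry A (Y * Z) hA hY
  refine ⟨C, hC, ?_⟩
  -- `X` kills `D`, hence so does `Y`: matrices with equal Gram matrices have equal kernels.
  set D : Matrix c c ℂ := 1 - Z * (Aᴴ * X)
  have hXD : X * D = 0 := by
    rw [Matrix.mul_sub, Matrix.mul_one, ← Matrix.mul_assoc, ← hZ, ← Matrix.mul_assoc, hAX, sub_self]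
  have hYD : Y * D = 0 := by
    rw [← Matrix.trace_conjTranspose_mul_self_eq_zero_iff, Matrix.conjTranspose_mul,
      Matrix.mul_assoc, ← Matrix.mul_assoc Yᴴ, ← h, Matrix.mul_assoc, hXD]
    simp
  have : Y = Y * Z * (Aᴴ * X) := by
    rw [Matrix.mul_sub, Matrix.mul_one, sub_eq_zero] at hYD
    rw [Matrix.mul_assoc]; exact hYD
  rw [this, ← hCA, Matrix.mul_assoc, ← Matrix.mul_assoc A, hAX]

/-- A Gram-preserving pair of matrices is related by an isometry into a larger space. -/
lemma exists_isometry_mul_eq {β : Type*} [Fintype β] [DecidableEq β]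
    (hcard : Fintype.card β ≤ Fintype.card m) (X : Matrix β c ℂ) (Y : Matrix m c ℂ)
    (h : Xᴴ * X = Yᴴ * Y) : ∃ W : Matrix m β ℂ, Wᴴ * W = 1 ∧ W * X = Y := by
  obtain ⟨f⟩ := Function.Embedding.nonempty_of_card_le hcard
  let E : Matrix m β ℂ := Matrix.of fun x b => if x = f b then 1 else 0
  have hE : Eᴴ * E = 1 := by
    ext b b'
    simp [E, Matrix.mul_apply, Matrix.one_apply, eq_comm]
  obtain ⟨C, hC, hCX⟩ := exists_unitary_mul_eq (E * X) Y (by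
    rw [Matrix.conjTranspose_mul, Matrix.mul_assoc, ← Matrix.mul_assoc Eᴴ, hE, Matrix.one_mul, h])
  refine ⟨C * E, ?_, by rw [Matrix.mul_assoc, hCX]⟩
  rw [Matrix.mem_unitaryGroup_iff', Matrix.star_eq_conjTranspose] at hC
  rw [Matrix.conjTranspose_mul, Matrix.mul_assoc, ← Matrix.mul_assoc Cᴴ, hC, Matrix.one_mul, hE]

/-- Matrices indexed by classes whose column spaces are orthogonal for different classes are
separated by a projective measurement. -/
lemma exists_projectiveMeasurement [Fintype ι] [DecidableEq ι] [Nonempty ι] (X : ι → Matrix m c ℂ)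
    (f : ι → ι) (h : ∀ r s, f r ≠ f s → (X r)ᴴ * X s = 0) :
    ∃ P : ι → Matrix m m ℂ, IsProjectiveMeasurement P ∧ ∀ r, P (f r) * X r = X r := by
  -- The blocks of class `d` side by side, padded with zero columns: one column space for the whole
  -- class.
  let Y : ι → Matrix m (ι × c) ℂ := fun d => Matrix.of fun x y => if f y.1 = d then X y.1 x y.2 else 0
  have hY : ∀ d e, d ≠ e → (Y d)ᴴ * Y e = 0 := by
    intro d e hde
    ext ⟨r, y⟩ ⟨s, y'⟩
    simp only [Matrix.mul_apply, Matrix.conjTranspose_apply, Y, Matrix.of_apply, Matrix.zero_apply]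
    by_cases h1 : f r = d
    · by_cases h2 : f s = e
      · have := congrFun (congrFun (h r s (by rw [h1, h2]; exact hde)) y) y'
        simpa [h1, h2, Matrix.mul_apply] using this
      · simp [h2]
    · simp [h1]
  choose k A Z hA hAY hZ using fun d => exists_isometry_factor (Y d)
  let Q : ι → Matrix m m ℂ := fun d => A d * (A d)ᴴ
  have hQQ : ∀ d, Q d * Q d = Q d := fun d => by
    simp only [Q]
    rw [Matrix.mul_assoc, ← Matrix.mul_assoc (A d)ᴴ, hA, Matrix.one_mul]
  have hQs : ∀ d, (Q d)ᴴ = Q d := fun d => by simp [Q]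
  have hQo : ∀ d e, d ≠ e → Q d * Q e = 0 := fun d e hde => by
    have : (A d)ᴴ * A e = 0 := by
      rw [hZ d, hZ e, Matrix.conjTranspose_mul, Matrix.mul_assoc, ← Matrix.mul_assoc (Y d)ᴴ,
        hY d e hde]
      simp
    simp only [Q]
    rw [Matrix.mul_assoc, ← Matrix.mul_assoc (A d)ᴴ, this]
    simp
  have hQX : ∀ r, Q (f r) * X r = X r := by
    intro r
    ext x y
    have := congrFun (congrFun (hAY (f r)) x) (r, y)
    simpa [Matrix.mul_apply, Y, Q] using this
  -- The part `R` that no class covers is added to the projector of an arbitrary index `d₀`.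
  obtain ⟨d₀⟩ := ‹Nonempty ι›
  let R : Matrix m m ℂ := 1 - ∑ d, Q d
  have hRs : Rᴴ = R := by
    simp [R, Matrix.conjTranspose_sum, hQs]
  have hSQ : ∀ d, (∑ e, Q e) * Q d = Q d := fun d => by
    rw [Finset.sum_mul, Finset.sum_eq_single d (fun e _ he => hQo e d he) (by simp), hQQ]
  have hRQ : ∀ d, R * Q d = 0 := fun d => by
    rw [Matrix.sub_mul, hSQ, Matrix.one_mul, sub_self]
  have hQR : ∀ d, Q d * R = 0 := fun d => by
    have := congrArg Matrix.conjTranspose (hRQ d)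
    simpa [hRs, hQs] using this
  have hRR : R * R = R := by
    conv_lhs => rw [show R * R = R * (1 - ∑ d, Q d) from rfl]
    rw [Matrix.mul_sub, Finset.mul_sum, Finset.sum_eq_zero (fun d _ => hRQ d)]
    simp
  refine ⟨fun d => Q d + if d = d₀ then R else 0, ⟨?_, ?_, ?_⟩, ?_⟩
  · intro d
    refine ⟨?_, ?_⟩
    · show _ * _ = _
      split_ifs <;> simp [add_mul, mul_add, hQQ, hQR, hRQ, hRR]
    · show _ᴴ = _
      split_ifs <;> simp [hQs, hRs]
  · intro d e hde
    by_cases h1 : d = d₀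
    · have h2 : e ≠ d₀ := fun h => hde (h1.trans h.symm)
      simp [h1, h2, add_mul, hRQ, hQo d₀ e (h1 ▸ hde)]
    · by_cases h2 : e = d₀ <;> simp [h1, h2, mul_add, hQR, hQo d e hde]
      exact hQo d d₀ h1
  · simp [Finset.sum_add_distrib, R]
  · intro r
    have : R * X r = 0 := by rw [← hQX r, ← Matrix.mul_assoc, hRQ, Matrix.zero_mul]
    simp only [Matrix.add_mul, hQX]
    split_ifs <;> simp [this]

end Tools

/-- Commuting Hermitian matrices are diagonal in a common orthonormal basis. -/
lemma exists_unitary_simultaneous_diagonal {k : ℕ} {ι : Type*}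
    (M : ι → Matrix (Fin k) (Fin k) ℂ) (hM : ∀ i, (M i).IsHermitian)
    (hc : ∀ i j, M i * M j = M j * M i) :
    ∃ (g : Matrix (Fin k) (Fin k) ℂ) (D : ι → Fin k → ℝ), gᴴ * g = 1 ∧
      ∀ i, M i * g = g * Matrix.diagonal fun r => (D i r : ℂ) := by
  classical
  let T : ι → EuclideanSpace ℂ (Fin k) →ₗ[ℂ] EuclideanSpace ℂ (Fin k) := fun i => (M i).toEuclideanLin
  have hT : ∀ i, (T i).IsSymmetric := fun i => Matrix.isSymmetric_toEuclideanLin_iff.2 (hM i)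
  have hC : Pairwise (Function.onFun Commute T) := by
    intro i j _
    show T i * T j = T j * T i
    ext v x
    simp [T, Matrix.mulVec_mulVec, hc i j]
  let V : (ι → ℂ) → Submodule ℂ (EuclideanSpace ℂ (Fin k)) :=
    fun χ => ⨅ i, Module.End.eigenspace (T i) (χ i)
  have hV : DirectSum.IsInternal V :=
    LinearMap.IsSymmetric.directSum_isInternal_of_pairwise_commute hT hC
  have hO : OrthogonalFamily ℂ (fun χ => V χ) fun χ => (V χ).subtypeₗᵢ :=
    LinearMap.IsSymmetric.orthogonalFamily_iInf_eigenspaces hT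
  -- The joint eigenspaces are indexed by all of `ι → ℂ`; only the finitely many nonzero ones can
  -- index a basis.
  have hfin : {χ | V χ ≠ ⊥}.Finite :=
    WellFoundedGT.finite_ne_bot_of_iSupIndep hV.submodule_iSupIndep
  have : Fintype {χ // V χ ≠ ⊥} := hfin.fintype
  have hV' : DirectSum.IsInternal (fun χ : {χ // V χ ≠ ⊥} => V χ) :=
    DirectSum.isInternal_ne_bot_iff.2 hV
  have hO' : OrthogonalFamily ℂ (fun χ : {χ // V χ ≠ ⊥} => V χ) fun χ => (V χ).subtypeₗᵢ :=
    hO.comp Subtype.val_injective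
  let b := hV'.subordinateOrthonormalBasis (n := k) (by simp) hO'
  have hb : ∀ r, ∃ χ : ι → ℂ, ∀ i, T i (b r) = χ i • b r := by
    intro r
    have := hV'.subordinateOrthonormalBasis_subordinate (n := k) (by simp) r hO'
    refine ⟨(hV'.subordinateOrthonormalBasisIndex (n := k) (by simp) r hO').1, fun i => ?_⟩
    exact Module.End.mem_eigenspace_iff.1 ((Submodule.mem_iInf _).1 this i)
  choose χ hχ using hb
  have hreal : ∀ r i, (((χ r i).re : ℝ) : ℂ) = χ r i := by
    intro r i
    have h1 := hT i (b r) (b r)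
    rw [hχ, inner_smul_left, inner_smul_right] at h1
    have h2 : inner ℂ (b r) (b r) = (1 : ℂ) := by simp
    rw [h2, mul_one, mul_one] at h1
    exact Complex.conj_eq_iff_re.1 h1
  refine ⟨Matrix.of fun x r => b r x, fun i r => (χ r i).re, ?_, ?_⟩
  · ext r s
    have := b.inner_eq_ite r s
    rw [EuclideanSpace.inner_eq_star_dotProduct] at this
    rw [Matrix.one_apply, ← this, Matrix.mul_apply, dotProduct]
    exact Finset.sum_congr rfl fun x _ => by simp [mul_comm]
  · intro i
    ext x r
    have := congrArg (fun v : EuclideanSpace ℂ (Fin k) => v x) (hχ r i)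
    simp only [T, hreal] at this ⊢
    rw [Matrix.mul_diagonal]
    simpa [Matrix.mul_apply, Matrix.mulVec, dotProduct, mul_comm] using this

/-! ### Reshaping: moving the qubit between rows and columns. -/

/-- The partial trace over the qubit in the second tensor factor. -/
def qubitTrace {κ κ' : Type*} (M : Matrix (κ × Fin 2) (κ' × Fin 2) ℂ) : Matrix κ κ' ℂ :=
  Matrix.of fun x y => ∑ a, M (x, a) (y, a)

/-- Moves the qubit from the row index to the column index. -/
def flat {β c : Type*} (M : Matrix (Fin 2 × β) c ℂ) : Matrix β (c × Fin 2) ℂ :=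
  Matrix.of fun b p => M (p.2, b) p.1

section Flat

variable {β γ c e : Type*}

lemma flat_mul [Fintype c] (M : Matrix (Fin 2 × β) c ℂ) (B : Matrix c e ℂ) :
    flat (M * B) = flat M * (B ⊗ₖ (1 : Matrix (Fin 2) (Fin 2) ℂ)) := by
  ext b ⟨y, a⟩
  simp [flat, Matrix.mul_apply, Fintype.sum_prod_type, Matrix.one_apply]

lemma flat_kronecker_mul [Fintype β] (P : Matrix γ β ℂ) (M : Matrix (Fin 2 × β) c ℂ) :
    flat (((1 : Matrix (Fin 2) (Fin 2) ℂ) ⊗ₖ P) * M) = P * flat M := by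
  ext b ⟨y, a⟩
  simp [flat, Matrix.mul_apply, Fintype.sum_prod_type, Matrix.one_apply, ite_mul]

lemma trace_flat_mul_conjTranspose [Fintype β] [Fintype c] (X Y : Matrix (Fin 2 × β) c ℂ) :
    (flat X * (flat Y)ᴴ).trace = (X * Yᴴ).trace := by
  simp only [flat, Matrix.trace, Matrix.diag_apply, Matrix.mul_apply, Fintype.sum_prod_type,
    Matrix.conjTranspose_apply, Matrix.of_apply]
  rw [Finset.sum_comm' (t' := Finset.univ) (s' := fun _ => Finset.univ) (by simp)]
  simp only [Fin.sum_univ_two, Finset.sum_add_distrib]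
  congr 1 <;> exact Finset.sum_comm

lemma qubitTrace_flat [Fintype β] (X : Matrix (Fin 2 × β) c ℂ) (Y : Matrix (Fin 2 × β) e ℂ) :
    qubitTrace ((flat X)ᴴ * flat Y) = Xᴴ * Y := by
  ext x y
  simp only [qubitTrace, flat, Matrix.mul_apply, Fintype.sum_prod_type,
    Matrix.conjTranspose_apply, Matrix.of_apply]

lemma flat_mul_conjTranspose_apply [Fintype c] (X : Matrix (Fin 2 × β) c ℂ) (x y : β) :
    (flat X * (flat X)ᴴ) x y = ∑ a, (X * Xᴴ) (a, x) (a, y) := by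
  simp only [flat, Matrix.mul_apply, Fintype.sum_prod_type,
    Matrix.conjTranspose_apply, Matrix.of_apply]
  exact Finset.sum_comm

lemma card_le_of_mul_eq_one [Fintype β] [Fintype c] [DecidableEq c] (Y : Matrix c β ℂ) (X : Matrix β c ℂ) (h : Y * X = 1) :
    Fintype.card c ≤ Fintype.card β := by
  have h1 := Matrix.rank_mul_le_left Y X
  rw [h, Matrix.rank_one] at h1
  exact h1.trans (Matrix.rank_le_card_width Y)

end Flat

/-! ### Bob's side: rank counting and the trace identity. -/

section Bob

variable {c : Type*} [Fintype c] {d : ℕ}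

/-- Rank counting: the four mutually orthogonal column spaces all have dimension `d / 2` and fill
`ℂ² ⊗ ℂ^d`. -/
lemma exists_common_rank_factor [DecidableEq c] (n : Fin 4 → Matrix (Fin 2 × Fin d) c ℂ)
    (Ω : Matrix (Fin d) (Fin d) ℂ) (hΩ : IsUnit Ω)
    (horth : ∀ i j, i ≠ j → (n i)ᴴ * n j = 0) (hmarg : ∀ i, flat (n i) * (flat (n i))ᴴ = Ω) :
    ∃ (k : ℕ) (A : Fin 4 → Matrix (Fin 2 × Fin d) (Fin k) ℂ) (B : Fin 4 → Matrix (Fin k) c ℂ)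
      (Z : Fin 4 → Matrix c (Fin k) ℂ),
      (∀ i, n i = A i * B i) ∧ (∀ i, B i * Z i = 1) ∧ (∀ i, (A i)ᴴ * A i = 1) ∧
      (∀ i j, i ≠ j → (A i)ᴴ * A j = 0) ∧ ∑ i, A i * (A i)ᴴ = 1 ∧ d = k * 2 := by
  choose k A Z hA hAn hZ using fun i => exists_isometry_factor (n i)
  have hAo : ∀ i j, i ≠ j → (A i)ᴴ * A j = 0 := fun i j hij => by
    rw [hZ i, hZ j, Matrix.conjTranspose_mul, Matrix.mul_assoc, ← Matrix.mul_assoc (n i)ᴴ,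
      horth i j hij]
    simp
  let T : Matrix (Fin 2 × Fin d) (Σ i, Fin (k i)) ℂ := Matrix.of fun x p => A p.1 x p.2
  have hT : Tᴴ * T = 1 := by
    ext ⟨i, x⟩ ⟨j, y⟩
    have h0 : (Tᴴ * T) ⟨i, x⟩ ⟨j, y⟩ = ((A i)ᴴ * A j) x y := by
      simp [T, Matrix.mul_apply]
    rw [h0]
    by_cases hij : i = j
    · subst hij
      rw [hA]
      simp [Matrix.one_apply]
    · rw [hAo i j hij, Matrix.one_apply_ne (by simp [hij])]
      rfl
  -- The orthogonal ranges fit in ℂ² ⊗ ℂ^d, so the ranks `k i` sum to at most 2d.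
  have hle := card_le_of_mul_eq_one _ _ hT
  -- The invertible marginal factors through ℂ^(k i) ⊗ ℂ². Together with `hle` this forces every `k
  -- i` to be d/2.
  have hge : ∀ i, d ≤ k i * 2 := fun i => by
    obtain ⟨Y, hY⟩ := hΩ.exists_right_inv
    have := hmarg i
    rw [← hAn i, Matrix.mul_assoc, flat_mul] at this
    rw [← this, Matrix.mul_assoc, Matrix.mul_assoc] at hY
    simpa using card_le_of_mul_eq_one _ _ hY
  have hk : k = fun _ => k 0 := by
    simp only [Fintype.card_sigma, Fintype.card_fin, Fin.sum_univ_four, Fintype.card_prod] at hle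
    have h0 := hge 0
    have h1 := hge 1
    have h2 := hge 2
    have h3 := hge 3
    funext i
    fin_cases i <;> simp <;> omega
  have hd : d = k 0 * 2 := by
    simp only [Fintype.card_sigma, Fintype.card_fin, Fin.sum_univ_four, Fintype.card_prod] at hle
    have h0 := hge 0
    have h1 := hge 1
    have h2 := hge 2
    have h3 := hge 3
    omega
  generalize k 0 = k₀ at hk hd
  subst hk
  refine ⟨k₀, A, fun i => (A i)ᴴ * n i, Z, fun i => by rw [← Matrix.mul_assoc, hAn],
    fun i => by rw [Matrix.mul_assoc, ← hZ, hA], hA, hAo, ?_, hd⟩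
  -- The stacked isometry is now square, hence unitary.
  have hT' : T * Tᴴ = 1 := by
    rw [Matrix.mul_eq_one_comm_of_card_eq _ _ _ (by simp; omega)]
    exact hT
  rw [← hT']
  ext x y
  simp [Matrix.sum_apply, Matrix.mul_apply, T, Fintype.sum_sigma]

lemma isUnit_mul_conjTranspose {k : ℕ} (B : Matrix (Fin k) c ℂ) (Z : Matrix c (Fin k) ℂ)
    (h : B * Z = 1) : IsUnit (B * Bᴴ) := by
  apply Matrix.PosDef.isUnit
  apply Matrix.PosDef.mul_conjTranspose_self
  intro v w hvw
  have := congrArg (fun v => v ᵥ* Z) hvw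
  simpa [Matrix.vecMul_vecMul, h] using this

/-- Each `√2 • flat (A i)` is unitary: equality in the trace inequality
`Tr Ω⁻¹ ≥ 4 Tr Λ_i⁻¹`. -/
lemma two_smul_conjTranspose_flat_mul_flat {k : ℕ} (n : Fin 4 → Matrix (Fin 2 × Fin d) c ℂ)
    (Ω : Matrix (Fin d) (Fin d) ℂ) (hΩ : IsUnit Ω)
    (hmarg : ∀ i, flat (n i) * (flat (n i))ᴴ = Ω)
    (A : Fin 4 → Matrix (Fin 2 × Fin d) (Fin k) ℂ) (B : Fin 4 → Matrix (Fin k) c ℂ)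
    (Z : Fin 4 → Matrix c (Fin k) ℂ) (hn : ∀ i, n i = A i * B i) (hBZ : ∀ i, B i * Z i = 1)
    (hA : ∀ i, (A i)ᴴ * A i = 1) (hsum : ∑ i, A i * (A i)ᴴ = 1) (hd : d = k * 2) (i : Fin 4) :
    (2 : ℂ) • ((flat (A i))ᴴ * flat (A i)) = 1 ∧ (2 : ℂ) • (flat (A i) * (flat (A i))ᴴ) = 1 := by
  -- Below, `Y`, `M i`, `X i` are the inverses of `Ω`, `B i * (B i)ᴴ`, `R i`; the last exists
  -- because `d = k * 2` makes `R i` square.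
  obtain ⟨Y, hY⟩ := hΩ.exists_right_inv
  let R := fun i => flat (A i)
  choose M hM using fun i => (isUnit_mul_conjTranspose (B i) (Z i) (hBZ i)).exists_right_inv
  have hM' : ∀ i, M i * (B i * (B i)ᴴ) = 1 := fun i => mul_eq_one_comm.1 (hM i)
  have hMs : ∀ i, (M i)ᴴ = M i := fun i => by
    have h1 : (B i * (B i)ᴴ) * (M i)ᴴ = 1 := by
      have := congrArg Matrix.conjTranspose (hM' i)
      simpa [Matrix.conjTranspose_mul] using this
    calc (M i)ᴴ = M i * (B i * (B i)ᴴ) * (M i)ᴴ := by rw [hM', Matrix.one_mul]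
      _ = M i := by rw [Matrix.mul_assoc, h1, Matrix.mul_one]
  let K := fun i => (B i)ᴴ * M i
  have hBK : ∀ i, B i * K i = 1 := fun i => by simp only [K]; rw [← Matrix.mul_assoc, hM]
  have hKK : ∀ i, (K i)ᴴ * K i = M i := fun i => by
    simp only [K]
    rw [Matrix.conjTranspose_mul, hMs, Matrix.conjTranspose_conjTranspose, Matrix.mul_assoc,
      ← Matrix.mul_assoc (B i), hM, Matrix.mul_one]
  let I2 : Matrix (Fin 2) (Fin 2) ℂ := 1
  let L := fun i => (B i * (B i)ᴴ) ⊗ₖ I2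
  let G := fun i => M i ⊗ₖ I2
  have hLG : ∀ i, L i * G i = 1 := fun i => by
    simp only [L, G, I2]
    rw [← Matrix.mul_kronecker_mul, hM, Matrix.one_mul, Matrix.one_kronecker_one]
  have hΩR : ∀ i, Ω = R i * L i * (R i)ᴴ := fun i => by
    rw [← hmarg i, hn i, flat_mul, Matrix.conjTranspose_mul, Matrix.conjTranspose_kronecker]
    simp only [L, R, I2, Matrix.conjTranspose_one, Matrix.mul_assoc]
    rw [← Matrix.mul_assoc (B i ⊗ₖ 1), ← Matrix.mul_kronecker_mul, Matrix.one_mul]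
  have hinv : ∀ i, ∃ X : Matrix (Fin k × Fin 2) (Fin d) ℂ, R i * X = 1 ∧ X * R i = 1 := fun i => by
    have h := hY
    rw [hΩR i, Matrix.mul_assoc, Matrix.mul_assoc] at h
    exact ⟨_, h, (Matrix.mul_eq_one_comm_of_card_eq _ _ _ (by simp; omega)).1 h⟩
  choose X hRX hXR using hinv
  have hYX : ∀ i, Y = (X i)ᴴ * G i * X i := fun i => by
    have hRX' : (R i)ᴴ * (X i)ᴴ = 1 := by
      have := congrArg Matrix.conjTranspose (hXR i)
      simpa [Matrix.conjTranspose_mul] using this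
    have h1 : Ω * ((X i)ᴴ * G i * X i) = 1 := by
      calc Ω * ((X i)ᴴ * G i * X i)
          = R i * (L i * (((R i)ᴴ * (X i)ᴴ) * G i)) * X i := by
            rw [hΩR i]; simp only [Matrix.mul_assoc]
        _ = 1 := by rw [hRX', Matrix.one_mul, hLG, Matrix.mul_one, hRX]
    have h2 : Y * Ω = 1 := mul_eq_one_comm.1 hY
    calc Y = Y * (Ω * ((X i)ᴴ * G i * X i)) := by rw [h1, Matrix.mul_one]
      _ = _ := by rw [← Matrix.mul_assoc, h2, Matrix.one_mul]
  have hXRs : ∀ i, (R i)ᴴ * (X i)ᴴ = 1 := fun i => by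
    have := congrArg Matrix.conjTranspose (hXR i)
    simpa [Matrix.conjTranspose_mul] using this
  have htG : ∀ i, (G i).trace = 2 * (M i).trace := fun i => by
    simp [G, I2, Matrix.trace_kronecker, mul_comm]
  -- The resolution of the identity `hsum`, traced over the qubit.
  have hRR : ∑ i, R i * (R i)ᴴ = (2 : ℂ) • 1 := by
    ext x y
    have h1 : ∀ a : Fin 2, ∑ i, (A i * (A i)ᴴ) (a, x) (a, y) = if x = y then 1 else 0 := fun a => by
      rw [← Matrix.sum_apply, hsum]
      simp [Matrix.one_apply]
    simp only [R, Matrix.sum_apply, flat_mul_conjTranspose_apply]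
    rw [Finset.sum_comm]
    simp only [h1]
    simp [Matrix.one_apply]
  have hw : Y.trace = ∑ i, (M i).trace := by
    have h1 : (Y * ∑ i, R i * (R i)ᴴ).trace = 2 * Y.trace := by
      rw [hRR]; simp
    have h2 : ∀ i, (Y * (R i * (R i)ᴴ)).trace = 2 * (M i).trace := fun i => by
      rw [← htG, ← Matrix.mul_assoc, Matrix.trace_mul_comm, hYX i]
      have : (R i)ᴴ * ((X i)ᴴ * G i * X i * R i) = G i := by
        calc _ = ((R i)ᴴ * (X i)ᴴ) * G i * (X i * R i) := by simp only [Matrix.mul_assoc]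
          _ = _ := by rw [hXRs, hXR, Matrix.one_mul, Matrix.mul_one]
      rw [this]
    rw [Matrix.mul_sum, Matrix.trace_sum] at h1
    simp only [h2] at h1
    rw [← Finset.mul_sum] at h1
    exact (mul_left_cancel₀ two_ne_zero h1).symm
  have htR : ∀ i, (R i * G i * (R i)ᴴ).trace = (M i).trace := fun i => by
    simp only [R, G, I2]
    rw [← flat_mul, trace_flat_mul_conjTranspose, Matrix.trace_mul_comm, ← Matrix.mul_assoc, hA,
      Matrix.one_mul]
  -- The weighted deviation of `X i` from `2 • (R i)ᴴ`. Its squared norm is `Y.trace - 4 * (M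
  -- i).trace`, and by `hw` these four nonnegative numbers add up to zero.
  let V := fun i => (K i ⊗ₖ I2) * (X i - (2 : ℂ) • (R i)ᴴ)
  have hKG : ∀ i, (K i ⊗ₖ I2)ᴴ * (K i ⊗ₖ I2) = G i := fun i => by
    simp only [G, I2]
    rw [Matrix.conjTranspose_kronecker, ← Matrix.mul_kronecker_mul, hKK]
    simp
  have hq : ∀ i, ((V i)ᴴ * V i).trace = Y.trace - 4 * (M i).trace := fun i => by
    have h1 : (V i)ᴴ * V i = (X i)ᴴ * G i * X i - (2 : ℂ) • (R i * (G i * X i))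
        - (2 : ℂ) • ((X i)ᴴ * G i * (R i)ᴴ) + (4 : ℂ) • (R i * G i * (R i)ᴴ) := by
      simp only [V]
      rw [Matrix.conjTranspose_mul, Matrix.mul_assoc, ← Matrix.mul_assoc (K i ⊗ₖ I2)ᴴ, hKG]
      simp only [Matrix.conjTranspose_sub, Matrix.conjTranspose_smul, Matrix.sub_mul, Matrix.mul_sub,
        Matrix.smul_mul, Matrix.mul_smul, Matrix.conjTranspose_conjTranspose, Matrix.mul_assoc,
        star_ofNat]
      module
    rw [h1, ← hYX i]
    simp only [Matrix.trace_add, Matrix.trace_sub, Matrix.trace_smul, htR, smul_eq_mul]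
    rw [Matrix.trace_mul_comm (R i), Matrix.mul_assoc, hXR, Matrix.mul_one,
      Matrix.trace_mul_comm ((X i)ᴴ * G i), ← Matrix.mul_assoc, hXRs, Matrix.one_mul, htG]
    ring
  have hq0 : ∑ i, ((V i)ᴴ * V i).trace = 0 := by
    simp only [hq, Finset.sum_sub_distrib, ← Finset.mul_sum, ← hw]
    simp
  have hVi : V i = 0 := by
    rw [Finset.sum_eq_zero_iff_of_nonneg
      (fun i _ => (Matrix.posSemidef_conjTranspose_mul_self (V i)).trace_nonneg)] at hq0
    exact Matrix.trace_conjTranspose_mul_self_eq_zero_iff.1 (hq0 i (Finset.mem_univ i))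
  have hX : X i = (2 : ℂ) • (R i)ᴴ := by
    -- `B i` is a left inverse of `K i`, which removes the weight.
    have : (B i ⊗ₖ I2) * V i = 0 := by rw [hVi, Matrix.mul_zero]
    simp only [V, I2] at this
    rw [← Matrix.mul_assoc, ← Matrix.mul_kronecker_mul, hBK, Matrix.one_mul,
      Matrix.one_kronecker_one, Matrix.one_mul, sub_eq_zero] at this
    exact this
  have h1 := hRX i
  have h2 := hXR i
  rw [hX] at h1 h2
  rw [Matrix.mul_smul] at h1
  rw [Matrix.smul_mul] at h2
  exact ⟨h2, h1⟩

/-- Bob's half of the rigidity statement. -/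
lemma exists_unitaries_of_orthogonal [DecidableEq c] {β : Type*} [Fintype β] [DecidableEq β]
    (N : Fin 4 → Matrix (Fin 2 × β) c ℂ) (ω : Matrix β β ℂ)
    (horth : ∀ i j, i ≠ j → (N i)ᴴ * N j = 0) (hmarg : ∀ i, flat (N i) * (flat (N i))ᴴ = ω) :
    ∃ (k : ℕ) (J : Matrix β (Fin k × Fin 2) ℂ)
      (u : Fin 4 → Matrix (Fin k × Fin 2) (Fin k × Fin 2) ℂ) (B : Fin 4 → Matrix (Fin k) c ℂ),
      Jᴴ * J = 1 ∧ (∀ i, (u i)ᴴ * u i = 1) ∧ u 0 = 1 ∧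
      (∀ i j, i ≠ j → qubitTrace ((u i)ᴴ * u j) = 0) ∧
      ∀ i, flat (N i) = ((Real.sqrt 2 : ℂ))⁻¹ •
        (J * u i * (B i ⊗ₖ (1 : Matrix (Fin 2) (Fin 2) ℂ))) := by
  classical
  obtain ⟨d, J, Z, hJ, hJF, hZ⟩ := exists_isometry_factor (flat (N 0))
  -- All marginals equal `ω`, so every `flat (N i)` has its range inside that of `flat (N 0)`.
  have hD : ∀ i, J * Jᴴ * flat (N i) = flat (N i) := fun i => by
    have h0 : ((1 - J * Jᴴ) * flat (N i)) * ((1 - J * Jᴴ) * flat (N i))ᴴ = 0 := by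
      calc _ = (1 - J * Jᴴ) * (flat (N i) * (flat (N i))ᴴ) * (1 - J * Jᴴ)ᴴ := by
            rw [Matrix.conjTranspose_mul]; simp only [Matrix.mul_assoc]
        _ = ((1 - J * Jᴴ) * flat (N 0)) * (flat (N 0))ᴴ * (1 - J * Jᴴ)ᴴ := by
            rw [hmarg i, ← hmarg 0]; simp only [Matrix.mul_assoc]
        _ = 0 := by rw [Matrix.sub_mul, Matrix.one_mul, hJF]; simp
    rw [Matrix.self_mul_conjTranspose_eq_zero, Matrix.sub_mul, Matrix.one_mul, sub_eq_zero] at h0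
    exact h0.symm
  let n : Fin 4 → Matrix (Fin 2 × Fin d) c ℂ := fun i => ((1 : Matrix (Fin 2) (Fin 2) ℂ) ⊗ₖ Jᴴ) * N i
  have hn : ∀ i, flat (n i) = Jᴴ * flat (N i) := fun i => flat_kronecker_mul _ _
  have hNn : ∀ i, N i = ((1 : Matrix (Fin 2) (Fin 2) ℂ) ⊗ₖ J) * n i := fun i => by
    have h1 : flat (((1 : Matrix (Fin 2) (Fin 2) ℂ) ⊗ₖ J) * n i) = flat (N i) := by
      rw [flat_kronecker_mul, hn, ← Matrix.mul_assoc, hD]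
    ext ⟨a, b⟩ y
    exact (congrFun (congrFun h1 b) (y, a)).symm
  have hno : ∀ i j, i ≠ j → (n i)ᴴ * n j = 0 := fun i j hij => by
    rw [← horth i j hij]
    conv_rhs => rw [hNn i, hNn j, Matrix.conjTranspose_mul, Matrix.mul_assoc,
      ← Matrix.mul_assoc (_ ⊗ₖ _)ᴴ, Matrix.conjTranspose_kronecker, ← Matrix.mul_kronecker_mul, hJ,
      Matrix.conjTranspose_one, Matrix.one_mul, Matrix.one_kronecker_one, Matrix.one_mul]
  have hnm : ∀ i, flat (n i) * (flat (n i))ᴴ = Jᴴ * ω * J := fun i => by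
    rw [hn, Matrix.conjTranspose_mul, ← hmarg i]
    simp [Matrix.mul_assoc]
  have hΩ : IsUnit (Jᴴ * ω * J) := by
    rw [← hnm 0]
    refine isUnit_mul_conjTranspose (flat (n 0)) Z ?_
    rw [hn, Matrix.mul_assoc, ← hZ, hJ]
  obtain ⟨k, A, B, Z', hnA, hBZ, hA, hAo, hsum, hd⟩ := exists_common_rank_factor n _ hΩ hno hnm
  have hR := two_smul_conjTranspose_flat_mul_flat n _ hΩ hnm A B Z' hnA hBZ hA hsum hd
  have hs : (Real.sqrt 2 : ℂ) * (Real.sqrt 2 : ℂ) = 2 := by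
    rw [← Complex.ofReal_mul, Real.mul_self_sqrt (by norm_num)]; simp
  have hs0 : (Real.sqrt 2 : ℂ) ≠ 0 := fun h => by simp [h] at hs
  have hR0 : ∀ i, flat (A 0) * ((2 : ℂ) • ((flat (A 0))ᴴ * flat (A i))) = flat (A i) := fun i => by
    rw [Matrix.mul_smul, ← Matrix.mul_assoc, ← Matrix.smul_mul, (hR 0).2, Matrix.one_mul]
  have hprod : ∀ i j, ((2 : ℂ) • ((flat (A 0))ᴴ * flat (A i)))ᴴ *
      ((2 : ℂ) • ((flat (A 0))ᴴ * flat (A j))) = (2 : ℂ) • ((flat (A i))ᴴ * flat (A j)) := fun i j => by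
    rw [Matrix.conjTranspose_smul, star_ofNat, Matrix.conjTranspose_mul,
      Matrix.conjTranspose_conjTranspose, Matrix.smul_mul, Matrix.mul_assoc, hR0]
  -- Absorbing the unitary `√2 • flat (A 0)` into Bob's isometry normalizes `u 0` to 1.
  refine ⟨k, (Real.sqrt 2 : ℂ) • (J * flat (A 0)), fun i => (2 : ℂ) • ((flat (A 0))ᴴ * flat (A i)), B,
    ?_, ?_, (hR 0).1, ?_, ?_⟩
  · rw [Matrix.conjTranspose_smul, Matrix.smul_mul, Matrix.mul_smul, smul_smul, Complex.star_def,
      Complex.conj_ofReal, hs, Matrix.conjTranspose_mul, Matrix.mul_assoc, ← Matrix.mul_assoc Jᴴ, hJ,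
      Matrix.one_mul, (hR 0).1]
  · intro i
    rw [hprod, (hR i).1]
  · intro i j hij
    rw [hprod]
    have h2 : ∀ M : Matrix (Fin k × Fin 2) (Fin k × Fin 2) ℂ,
        qubitTrace ((2 : ℂ) • M) = (2 : ℂ) • qubitTrace M := fun M => by
      ext; simp [qubitTrace, mul_add]
    rw [h2, qubitTrace_flat, hAo i j hij, smul_zero]
  · intro i
    rw [Matrix.smul_mul, Matrix.mul_assoc J, hR0, Matrix.smul_mul, smul_smul, inv_mul_cancel₀ hs0, one_smul, ← hD i,
      Matrix.mul_assoc, ← hn, hnA, flat_mul, Matrix.mul_assoc]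

end Bob

/-! ### Matrices with coefficients in the traceless Pauli matrices. -/

section PauliAlgebra

variable {κ κ' κ'' : Type*}

/-- The matrix `∑ₛ Xₛ ⊗ σₛ` over the traceless Pauli matrices. -/
def pauliSum (X : Fin 3 → Matrix κ κ' ℂ) : Matrix (κ × Fin 2) (κ' × Fin 2) ℂ :=
  ∑ s, X s ⊗ₖ pauli s.succ

lemma conjTranspose_pauli (i : Fin 4) : (pauli i)ᴴ = pauli i := by
  fin_cases i <;> ext a b <;> fin_cases a <;> fin_cases b <;> simp [pauli]

lemma conjTranspose_pauliSum (X : Fin 3 → Matrix κ κ' ℂ) :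
    (pauliSum X)ᴴ = pauliSum fun s => (X s)ᴴ := by
  simp [pauliSum, Matrix.conjTranspose_sum, Matrix.conjTranspose_kronecker, conjTranspose_pauli]

lemma pauliSum_mul_apply [Fintype κ'] (A : Fin 3 → Matrix κ κ' ℂ) (B : Fin 3 → Matrix κ' κ'' ℂ) (x : κ) (y : κ'')
    (a b : Fin 2) : (pauliSum A * pauliSum B) (x, a) (y, b) =
      ∑ s, ∑ t, (A s * B t) x y * (pauli s.succ * pauli t.succ) a b := by
  simp only [pauliSum, Matrix.sum_mul, Matrix.mul_sum, ← Matrix.mul_kronecker_mul,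
    Matrix.sum_apply, Matrix.kroneckerMap_apply]
  exact Finset.sum_comm

lemma exists_eq_pauliSum (u : Matrix (κ × Fin 2) (κ' × Fin 2) ℂ) (hu : qubitTrace u = 0) :
    ∃ X : Fin 3 → Matrix κ κ' ℂ, u = pauliSum X := by
  let b : Fin 2 → Fin 2 → Matrix κ κ' ℂ := fun c d => Matrix.of fun x y => u (x, c) (y, d)
  refine ⟨![b 0 0, (1 / 2 : ℂ) • (b 0 1 + b 1 0), (Complex.I / 2) • (b 0 1 - b 1 0)], ?_⟩
  ext ⟨x, c⟩ ⟨y, d⟩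
  have h := congrFun (congrFun hu x) y
  simp only [qubitTrace, Matrix.of_apply, Fin.sum_univ_two, Matrix.zero_apply] at h
  fin_cases c <;> fin_cases d <;>
    simp [pauliSum, Fin.sum_univ_three, pauli, b]
  · linear_combination (u (x, 0) (y, 1) - u (x, 1) (y, 0)) / 2 * Complex.I_sq
  · linear_combination -(u (x, 0) (y, 1) - u (x, 1) (y, 0)) / 2 * Complex.I_sq
  · linear_combination h

/-- In the order Z, X, Y one has `σₛσₜ = δₛₜ + i ∑ εₛₜᵣ σᵣ`. The coefficients of the `σᵣ` are the
antisymmetrized products, and that of the identity is the sum. -/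
lemma pauliSum_mul_eq_one [Fintype κ'] [DecidableEq κ] (A : Fin 3 → Matrix κ κ' ℂ) (B : Fin 3 → Matrix κ' κ ℂ)
    (h : pauliSum A * pauliSum B = 1) :
    (∀ s t, A s * B t = A t * B s) ∧ ∑ s, A s * B s = 1 := by
  have e : ∀ x y a b, (∑ s, ∑ t, (A s * B t) x y * (pauli s.succ * pauli t.succ) a b)
      = if x = y ∧ a = b then 1 else 0 := fun x y a b => by
    rw [← pauliSum_mul_apply, h, Matrix.one_apply]
    simp
  have e00 := fun x y => e x y 0 0
  have e01 := fun x y => e x y 0 1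
  have e10 := fun x y => e x y 1 0
  have e11 := fun x y => e x y 1 1
  simp [Fin.sum_univ_three, pauli, Matrix.mul_apply, Fin.sum_univ_two] at e00 e01 e10 e11
  simp only [← Matrix.mul_apply] at e00 e01 e10 e11
  have h12 : A 1 * B 2 = A 2 * B 1 := by
    ext x y
    linear_combination (-Complex.I / 2) * (e00 x y - e11 x y) +
      ((A 1 * B 2) x y - (A 2 * B 1) x y) * Complex.I_sq
  have h02 : A 0 * B 2 = A 2 * B 0 := by
    ext x y
    linear_combination (Complex.I / 2) * (e01 x y + e10 x y) +
      ((A 0 * B 2) x y - (A 2 * B 0) x y) * Complex.I_sq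
  have h01 : A 0 * B 1 = A 1 * B 0 := by
    ext x y
    linear_combination (1 / 2) * (e01 x y - e10 x y)
  refine ⟨fun s t => ?_, ?_⟩
  · fin_cases s <;> fin_cases t <;> simp [h12, h02, h01]
  · ext x y
    simp only [Fin.sum_univ_three, Matrix.add_apply, Matrix.one_apply]
    linear_combination (1 / 2) * (e00 x y + e11 x y)

lemma qubitTrace_pauliSum_mul [Fintype κ'] (A : Fin 3 → Matrix κ κ' ℂ) (B : Fin 3 → Matrix κ' κ'' ℂ) :
    qubitTrace (pauliSum A * pauliSum B) = (2 : ℂ) • ∑ s, A s * B s := by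
  ext x y
  simp only [qubitTrace, Matrix.of_apply, pauliSum_mul_apply]
  simp [Fin.sum_univ_three, pauli, Matrix.mul_apply, Fin.sum_univ_two]
  simp only [← Matrix.mul_apply]
  ring

end PauliAlgebra

/-! ### Frames in ℝ³ and spin observables. -/

section Vectors

/-- The exchange of the middle indices says that `q` has rank one; a row through a positive diagonal
entry, divided by the root of that entry, is the vector. -/
lemma exists_unit_vector_of_rank_one (q : Fin 3 → Fin 3 → ℝ)
    (hq : ∀ a b c d, q a b * q c d = q a c * q b d) (htr : ∑ a, q a a = 1) :
    ∃ n : Fin 3 → ℝ, (∀ a b, q a b = n a * n b) ∧ n ⬝ᵥ n = 1 := by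
  obtain ⟨a, ha⟩ : ∃ a, 0 < q a a := by
    by_contra! h
    have := Finset.sum_nonpos fun a (_ : a ∈ Finset.univ) => h a
    linarith
  have key : ∀ b c, q b c = q a b / Real.sqrt (q a a) * (q a c / Real.sqrt (q a a)) := by
    intro b c
    rw [div_mul_div_comm, Real.mul_self_sqrt ha.le, eq_div_iff ha.ne', mul_comm, hq]
  refine ⟨fun b => q a b / Real.sqrt (q a a), key, ?_⟩
  rw [← htr, dotProduct]
  exact Finset.sum_congr rfl fun b _ => (key b b).symm

/-- The completeness relation of an oriented orthonormal frame in `ℝ³`. -/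
lemma orthonormal_frame_complete (n m : Fin 3 → ℝ) (hn : n ⬝ᵥ n = 1) (hm : m ⬝ᵥ m = 1)
    (hnm : n ⬝ᵥ m = 0) (a b : Fin 3) :
    n a * n b + m a * m b + (n ⨯₃ m) a * (n ⨯₃ m) b = if a = b then 1 else 0 := by
  let O : Matrix (Fin 3) (Fin 3) ℝ := Matrix.of ![n, m, n ⨯₃ m]
  have h1 : O * Oᵀ = 1 := by
    have hw : (n ⨯₃ m) ⬝ᵥ (n ⨯₃ m) = 1 := by
      rw [cross_dot_cross, hn, hm, dotProduct_comm m n, hnm]; ring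
    have e : ∀ i j, (O * Oᵀ) i j = ![n, m, n ⨯₃ m] i ⬝ᵥ ![n, m, n ⨯₃ m] j := fun i j => rfl
    ext i j
    rw [e]
    fin_cases i <;> fin_cases j <;>
      simp [hn, hm, hnm, hw, dotProduct_comm m n, dotProduct_comm (n ⨯₃ m), dot_self_cross,
        dot_cross_self]
  have h2 : Oᵀ * O = 1 := mul_eq_one_comm.1 h1
  have := congrFun (congrFun h2 a) b
  simpa [Matrix.mul_apply, Fin.sum_univ_three, O, Matrix.one_apply] using this

/-- A symmetric traceless matrix annihilating two unit vectors vanishes unless the vectors are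
parallel. -/
lemma symm_traceless_mul_sub_eq_zero (z : Fin 3 → Fin 3 → ℂ) (hz : ∀ a b, z a b = z b a)
    (htr : ∑ a, z a a = 0) (n m : Fin 3 → ℝ) (hn : n ⬝ᵥ n = 1) (hm : m ⬝ᵥ m = 1)
    (hzn : ∀ b, ∑ a, z a b * n a = 0) (hzm : ∀ b, ∑ a, z a b * m a = 0) (a b c d : Fin 3) :
    z a b * (m c * m d - n c * n d) = 0 := by
  simp only [Fin.sum_univ_three] at hzn hzm htr
  by_cases hw : n ⨯₃ m = 0
  -- Parallel unit vectors differ by a sign, so the second factor vanishes.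
  · have e : ∀ c, m c = (n ⬝ᵥ m) * n c := by
      have h0 := congrFun hw 0
      have h1 := congrFun hw 1
      have h2 := congrFun hw 2
      simp [cross_apply] at h0 h1 h2
      simp only [dotProduct, Fin.sum_univ_three] at hn ⊢
      intro c
      fin_cases c <;> simp
      · linear_combination -(m 0) * hn - n 1 * h2 + n 2 * h1
      · linear_combination -(m 1) * hn + n 0 * h2 - n 2 * h0
      · linear_combination -(m 2) * hn - n 0 * h1 + n 1 * h0
    have e2 : (n ⬝ᵥ m) * (n ⬝ᵥ m) = 1 := by
      have h : m ⬝ᵥ m = (n ⬝ᵥ m) * (n ⬝ᵥ m) := by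
        conv_lhs => rw [show m = (n ⬝ᵥ m) • n from funext e]
        simp [hn, dotProduct_smul]
      rw [← h, hm]
    have : m c * m d = n c * n d := by
      rw [e c, e d]
      linear_combination n c * n d * e2
    rw [← Complex.ofReal_mul, this]
    simp
  · set w := n ⨯₃ m with hwdef
    -- Each row of the symmetric `z` lies along `w`, so `z` is a multiple of `w wᵀ`. Its trace is
    -- zero, while `w ⬝ᵥ w ≠ 0` because `w` is real and nonzero.
    have hrow : ∀ a b c, z a b * w c = z a c * w b := by
      intro a b c
      have h1 := hzn a
      have h2 := hzm a
      rw [hz 0 a, hz 1 a, hz 2 a] at h1 h2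
      fin_cases b <;> fin_cases c <;> simp [w, cross_apply]
      · linear_combination n 2 * h2 - m 2 * h1
      · linear_combination -n 1 * h2 + m 1 * h1
      · linear_combination -n 2 * h2 + m 2 * h1
      · linear_combination n 0 * h2 - m 0 * h1
      · linear_combination n 1 * h2 - m 1 * h1
      · linear_combination -n 0 * h2 + m 0 * h1
    have hww : z a b * ((w ⬝ᵥ w : ℝ) : ℂ) = 0 := by
      have e : ∀ c, z a b * (w c * w c) = z c c * (w a * w b) := fun c => by
        linear_combination w c * hrow a b c + w b * (hrow c a c) + w b * w c * hz a c
      simp only [dotProduct, Fin.sum_univ_three]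
      push_cast
      linear_combination e 0 + e 1 + e 2 + w a * w b * htr
    rcases mul_eq_zero.1 hww with h | h
    · rw [h, zero_mul]
    · exact absurd (dotProduct_self_eq_zero.1 (by exact_mod_cast h)) hw

/-- The observable `n · σ`. -/
def spin (n : Fin 3 → ℝ) : Matrix (Fin 2) (Fin 2) ℂ := ∑ s, (n s : ℂ) • pauli s.succ

lemma spin_eq (n : Fin 3 → ℝ) : spin n =
    !![(n 0 : ℂ), n 1 - n 2 * Complex.I; n 1 + n 2 * Complex.I, -n 0] := by
  ext a b
  fin_cases a <;> fin_cases b <;> simp [spin, Fin.sum_univ_three, pauli] <;> ring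

lemma conjTranspose_spin (n : Fin 3 → ℝ) : (spin n)ᴴ = spin n := by
  simp [spin, Matrix.conjTranspose_sum, conjTranspose_pauli]

lemma spin_mul_spin (n m : Fin 3 → ℝ) :
    spin n * spin m = ((n ⬝ᵥ m : ℝ) : ℂ) • 1 + Complex.I • spin (n ⨯₃ m) := by
  rw [spin_eq, spin_eq, spin_eq]
  ext a b
  fin_cases a <;> fin_cases b <;>
    simp [Matrix.mul_apply, Fin.sum_univ_two, dotProduct, Fin.sum_univ_three, cross_apply]
  · linear_combination -(n 2 * m 2 : ℂ) * Complex.I_sq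
  · linear_combination (n 0 * m 1 - n 1 * m 0 : ℂ) * Complex.I_sq
  · linear_combination (n 1 * m 0 - n 0 * m 1 : ℂ) * Complex.I_sq
  · linear_combination -(n 2 * m 2 : ℂ) * Complex.I_sq

/-- The vector `(1 + n₀, n₁ + i n₂)`, of squared norm `2 (1 + n₀)`, is fixed. It vanishes only at
the pole `n₀ = -1`, where the second basis vector serves; `n 0` is the Z component. -/
lemma exists_spin_fixed_vector (n : Fin 3 → ℝ) (hn : n ⬝ᵥ n = 1) :
    ∃ x : Matrix (Fin 2) (Fin 1) ℂ, xᴴ * x = 1 ∧ spin n * x = x := by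
  simp only [dotProduct, Fin.sum_univ_three] at hn
  by_cases h : n 0 = -1
  · have h1 : n 1 = 0 := by nlinarith
    have h2 : n 2 = 0 := by nlinarith
    refine ⟨!![0; 1], ?_, ?_⟩
    · ext a b
      fin_cases a; fin_cases b
      simp [Matrix.mul_apply]
    · rw [spin_eq]
      ext a b
      fin_cases a <;> fin_cases b <;> simp [Matrix.mul_apply, h, h1, h2]
  · have hpos : 0 < 1 + n 0 := by
      have : -1 ≤ n 0 := by nlinarith
      have := lt_of_le_of_ne this (Ne.symm h)
      linarith
    have hs : (Real.sqrt (2 * (1 + n 0)) : ℂ) * (Real.sqrt (2 * (1 + n 0)) : ℂ) = 2 * (1 + n 0) := by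
      rw [← Complex.ofReal_mul, Real.mul_self_sqrt (by positivity)]
      push_cast; ring
    set t : ℝ := Real.sqrt (2 * (1 + n 0))
    have ht : (t : ℂ) ≠ 0 := by
      have : 0 < t := Real.sqrt_pos.2 (by positivity)
      exact_mod_cast this.ne'
    have hn' : (n 0 * n 0 + n 1 * n 1 + n 2 * n 2 : ℂ) = 1 := by exact_mod_cast hn
    refine ⟨(t : ℂ)⁻¹ • !![(1 + n 0 : ℂ); n 1 + n 2 * Complex.I], ?_, ?_⟩
    · rw [Matrix.conjTranspose_smul, Matrix.smul_mul, Matrix.mul_smul, smul_smul]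
      ext a b
      fin_cases a; fin_cases b
      simp [Matrix.mul_apply]
      field_simp
      linear_combination -hs + hn' - n 2 * n 2 * Complex.I_sq
    · rw [Matrix.mul_smul]
      congr 1
      rw [spin_eq]
      ext a b
      fin_cases a <;> fin_cases b <;> simp [Matrix.mul_apply]
      · linear_combination hn' - n 2 * n 2 * Complex.I_sq
      · ring

/-- Every oriented orthonormal frame of spin observables is unitarily conjugate to `Z, X, Y`. -/
lemma exists_unitary_conj_pauli (n m : Fin 3 → ℝ) (hn : n ⬝ᵥ n = 1) (hm : m ⬝ᵥ m = 1)
    (hnm : n ⬝ᵥ m = 0) : ∃ S ∈ Matrix.unitaryGroup (Fin 2) ℂ,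
      S * pauli 1 * Sᴴ = spin n ∧ S * pauli 2 * Sᴴ = spin m ∧ S * pauli 3 * Sᴴ = spin (n ⨯₃ m) := by
  obtain ⟨x, hx, hnx⟩ := exists_spin_fixed_vector n hn
  have hmm : spin m * spin m = 1 := by
    rw [spin_mul_spin, hm, cross_self]; simp [spin]
  have hmn : spin m * spin n = -(Complex.I • spin (n ⨯₃ m)) := by
    rw [spin_mul_spin, dotProduct_comm, hnm, ← cross_anticomm]; simp [spin]
  have hnm' : spin n * spin m = Complex.I • spin (n ⨯₃ m) := by
    rw [spin_mul_spin, hnm]; simp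
  -- `x` and `y` are eigenvectors of `spin n` for 1 and -1, exchanged by `spin m`; they become the
  -- columns of `S`.
  let y := spin m * x
  have hny : spin n * y = -y := by
    simp only [y]
    rw [← Matrix.mul_assoc, hnm', ← neg_eq_iff_eq_neg.2 hmn.symm.symm, Matrix.neg_mul,
      Matrix.mul_assoc, hnx]
  have hmy : spin m * y = x := by
    simp only [y]
    rw [← Matrix.mul_assoc, hmm, Matrix.one_mul]
  have hyy : yᴴ * y = 1 := by
    simp only [y]
    rw [Matrix.conjTranspose_mul, conjTranspose_spin, Matrix.mul_assoc, ← Matrix.mul_assoc (spin m),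
      hmm, Matrix.one_mul, hx]
  have hxy : xᴴ * y = 0 := by
    have h1 : xᴴ * y = -(xᴴ * y) := by
      conv_lhs => rw [← hnx, Matrix.conjTranspose_mul, conjTranspose_spin, Matrix.mul_assoc, hny,
        Matrix.mul_neg]
    ext a b
    exact self_eq_neg.1 (congrFun (congrFun h1 a) b)
  have hyx : yᴴ * x = 0 := by
    have := congrArg Matrix.conjTranspose hxy
    simpa [Matrix.conjTranspose_mul] using this
  let e0 : Matrix (Fin 1) (Fin 2) ℂ := !![1, 0]
  let e1 : Matrix (Fin 1) (Fin 2) ℂ := !![0, 1]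
  let S := x * e0 + y * e1
  have hS : Sᴴ * S = 1 := by
    have h1 : Sᴴ * S = e0ᴴ * (xᴴ * x) * e0 + e0ᴴ * (xᴴ * y) * e1 + e1ᴴ * (yᴴ * x) * e0
        + e1ᴴ * (yᴴ * y) * e1 := by
      simp only [S, Matrix.conjTranspose_add, Matrix.conjTranspose_mul, Matrix.add_mul,
        Matrix.mul_add, Matrix.mul_assoc]
      abel
    rw [h1, hx, hyy, hxy, hyx]
    ext a b
    fin_cases a <;> fin_cases b <;> simp [e0, e1, Matrix.mul_apply]
  have hS' : S * Sᴴ = 1 := mul_eq_one_comm.1 hS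
  have e0Z : e0 * pauli 1 = e0 := by
    ext a b; fin_cases a; fin_cases b <;> simp [e0, pauli]
  have e1Z : e1 * pauli 1 = -e1 := by
    ext a b; fin_cases a; fin_cases b <;> simp [e1, pauli]
  have e0X : e0 * pauli 2 = e1 := by
    ext a b; fin_cases a; fin_cases b <;> simp [e0, e1, pauli]
  have e1X : e1 * pauli 2 = e0 := by
    ext a b; fin_cases a; fin_cases b <;> simp [e0, e1, pauli]
  have hSZ : S * pauli 1 = spin n * S := by
    simp only [S, Matrix.add_mul, Matrix.mul_add, Matrix.mul_assoc, e0Z, e1Z]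
    rw [← Matrix.mul_assoc (spin n), ← Matrix.mul_assoc (spin n), hnx, hny]
    simp
  have hSX : S * pauli 2 = spin m * S := by
    simp only [S, Matrix.add_mul, Matrix.mul_add, Matrix.mul_assoc, e0X, e1X]
    rw [← Matrix.mul_assoc (spin m), ← Matrix.mul_assoc (spin m), hmy, add_comm]
  have hY : pauli 3 = Complex.I • (pauli 2 * pauli 1) := by
    ext a b; fin_cases a <;> fin_cases b <;> simp [pauli]
  refine ⟨S, (Matrix.mem_unitaryGroup_iff).2 hS', ?_, ?_, ?_⟩
  · rw [hSZ, Matrix.mul_assoc, hS', Matrix.mul_one]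
  · rw [hSX, Matrix.mul_assoc, hS', Matrix.mul_one]
  · rw [hY, Matrix.mul_smul, ← Matrix.mul_assoc, hSX, Matrix.mul_assoc, hSZ, ← Matrix.mul_assoc, hmn,
      Matrix.smul_mul, Matrix.mul_assoc, hS', Matrix.mul_one, smul_neg, smul_smul, Complex.I_mul_I]
    simp

end Vectors

/-! ### Unitary triples and their joint eigenvectors. -/

/-- The components of a unitary `∑ₛ Aₛ ⊗ σₛ`. -/
structure IsUnitaryTriple {k : ℕ} (A : Fin 3 → Matrix (Fin k) (Fin k) ℂ) : Prop where
  left_swap : ∀ s t, (A s)ᴴ * A t = (A t)ᴴ * A s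
  right_swap : ∀ s t, A s * (A t)ᴴ = A t * (A s)ᴴ
  left_sum : ∑ s, (A s)ᴴ * A s = 1
  right_sum : ∑ s, A s * (A s)ᴴ = 1

section Triples

variable {k : ℕ} {A B : Fin 3 → Matrix (Fin k) (Fin k) ℂ}

lemma isUnitaryTriple_of_unitary (h : (pauliSum A)ᴴ * pauliSum A = 1) : IsUnitaryTriple A := by
  have h' : pauliSum A * (pauliSum A)ᴴ = 1 := mul_eq_one_comm.1 h
  rw [conjTranspose_pauliSum] at h h'
  exact ⟨(pauliSum_mul_eq_one _ _ h).1, (pauliSum_mul_eq_one _ _ h').1,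
    (pauliSum_mul_eq_one _ _ h).2, (pauliSum_mul_eq_one _ _ h').2⟩

/-- Together with `right_swap` inside each factor, this exchange makes the product symmetric in all
four indices. Commutation and the rank-one form of the eigenvalues both follow. -/
lemma IsUnitaryTriple.gram_mul_gram (hA : IsUnitaryTriple A) (a b c d : Fin 3) :
    A a * (A b)ᴴ * (A c * (A d)ᴴ) = A a * (A c)ᴴ * (A b * (A d)ᴴ) := by
  calc _ = A a * ((A b)ᴴ * A c) * (A d)ᴴ := by simp only [Matrix.mul_assoc]
    _ = A a * ((A c)ᴴ * A b) * (A d)ᴴ := by rw [hA.left_swap]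
    _ = _ := by simp only [Matrix.mul_assoc]

lemma IsUnitaryTriple.gram_commute (hA : IsUnitaryTriple A) (a b c d : Fin 3) :
    A a * (A b)ᴴ * (A c * (A d)ᴴ) = A c * (A d)ᴴ * (A a * (A b)ᴴ) := by
  rw [hA.gram_mul_gram, hA.right_swap a c, hA.gram_mul_gram, hA.right_swap c b, hA.right_swap a d,
    hA.gram_mul_gram, hA.right_swap b d, hA.gram_mul_gram, hA.right_swap d c, hA.right_swap b a]

lemma IsUnitaryTriple.gram_isHermitian (hA : IsUnitaryTriple A) (a b : Fin 3) :
    (A a * (A b)ᴴ).IsHermitian := by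
  rw [Matrix.IsHermitian, Matrix.conjTranspose_mul, Matrix.conjTranspose_conjTranspose,
    hA.right_swap]

/-- A common eigenbasis `g` of the products `A a * (A b)ᴴ`, with eigenvalues `n r a * n r b`. -/
structure IsGramFrame (A : Fin 3 → Matrix (Fin k) (Fin k) ℂ) (g : Matrix (Fin k) (Fin k) ℂ)
    (n : Fin k → Fin 3 → ℝ) : Prop where
  unitary : gᴴ * g = 1
  diag : ∀ a b, gᴴ * (A a * (A b)ᴴ) * g =
    Matrix.diagonal fun r => ((n r a : ℂ) * (n r b : ℂ))
  unit : ∀ r, n r ⬝ᵥ n r = 1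

/-- For each eigenvector the eigenvalues form a real 3 × 3 matrix: `gram_mul_gram` makes it rank
one, and `right_sum` gives it trace one. -/
lemma IsUnitaryTriple.exists_isGramFrame (hA : IsUnitaryTriple A) (g : Matrix (Fin k) (Fin k) ℂ)
    (hg : gᴴ * g = 1) (D : Fin 3 → Fin 3 → Fin k → ℝ)
    (hD : ∀ a b, A a * (A b)ᴴ * g = g * Matrix.diagonal fun r => (D a b r : ℂ)) :
    ∃ n, IsGramFrame A g n := by
  have hdiag : ∀ a b, gᴴ * (A a * (A b)ᴴ) * g = Matrix.diagonal fun r => (D a b r : ℂ) :=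
    fun a b => by rw [Matrix.mul_assoc, hD, ← Matrix.mul_assoc, hg, Matrix.one_mul]
  have hmul : ∀ a b c d, gᴴ * (A a * (A b)ᴴ * (A c * (A d)ᴴ)) * g =
      Matrix.diagonal fun r => ((D a b r * D c d r : ℝ) : ℂ) := fun a b c d => by
    rw [Matrix.mul_assoc, Matrix.mul_assoc (A a * (A b)ᴴ), hD, ← Matrix.mul_assoc (A a * (A b)ᴴ), hD,
      Matrix.mul_assoc, ← Matrix.mul_assoc, hg, Matrix.one_mul, Matrix.diagonal_mul_diagonal]
    simp
  have hq : ∀ r a b c d, D a b r * D c d r = D a c r * D b d r := fun r a b c d => by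
    have := hmul a b c d
    rw [hA.gram_mul_gram, hmul] at this
    have := congrFun (Matrix.diagonal_injective this) r
    exact_mod_cast this.symm
  have htr : ∀ r, ∑ a, D a a r = 1 := fun r => by
    have h1 : gᴴ * (∑ a, A a * (A a)ᴴ) * g = 1 := by rw [hA.right_sum, Matrix.mul_one, hg]
    rw [Matrix.mul_sum, Matrix.sum_mul] at h1
    have := congrFun (congrFun h1 r) r
    simp only [hdiag, Matrix.sum_apply, Matrix.diagonal_apply_eq, Matrix.one_apply_eq] at this
    exact_mod_cast this
  choose n hn hn1 using fun r => exists_unit_vector_of_rank_one (fun a b => D a b r) (hq r) (htr r)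
  refine ⟨n, hg, fun a b => ?_, hn1⟩
  rw [hdiag]
  congr 1
  funext r
  rw [hn]
  push_cast
  rfl

lemma IsGramFrame.mul_conjTranspose {g : Matrix (Fin k) (Fin k) ℂ} {n : Fin k → Fin 3 → ℝ}
    (h : IsGramFrame A g n) : g * gᴴ = 1 := mul_eq_one_comm.1 h.unitary

lemma IsGramFrame.conjTranspose_mul {g : Matrix (Fin k) (Fin k) ℂ} {n : Fin k → Fin 3 → ℝ}
    (h : IsGramFrame A g n) (a b : Fin 3) : gᴴ * (A a * (A b)ᴴ) =
      Matrix.diagonal (fun r => ((n r a : ℂ) * (n r b : ℂ))) * gᴴ := by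
  rw [← h.diag, Matrix.mul_assoc _ g, h.mul_conjTranspose, Matrix.mul_one]

/-- In the eigenbasis, row `r` of the triple is proportional to `n r`. -/
lemma IsGramFrame.exists_factor {g : Matrix (Fin k) (Fin k) ℂ} {n : Fin k → Fin 3 → ℝ}
    (h : IsGramFrame A g n) (hA : IsUnitaryTriple A) : ∃ x : Matrix (Fin k) (Fin k) ℂ,
      xᴴ * x = 1 ∧ ∀ a, A a = g * (Matrix.diagonal (fun r => (n r a : ℂ)) * x) := by
  -- Found by inserting `∑ b, (A b)ᴴ * A b = 1` after `gᴴ * A a` and diagonalizing `A a * (A b)ᴴ`.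
  let x := ∑ b, Matrix.diagonal (fun r => (n r b : ℂ)) * (gᴴ * A b)
  have h1 : ∀ a, A a = g * (Matrix.diagonal (fun r => (n r a : ℂ)) * x) := fun a => by
    have h2 : gᴴ * A a = Matrix.diagonal (fun r => (n r a : ℂ)) * x := by
      calc gᴴ * A a = gᴴ * (A a * ∑ b, (A b)ᴴ * A b) := by rw [hA.left_sum, Matrix.mul_one]
        _ = ∑ b, gᴴ * (A a * (A b)ᴴ) * A b := by
          simp only [Matrix.mul_sum, Matrix.mul_assoc]
        _ = _ := by
          simp only [x, Matrix.mul_sum, h.conjTranspose_mul, ← Matrix.mul_assoc,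
            Matrix.diagonal_mul_diagonal]
    rw [← h2, ← Matrix.mul_assoc, h.mul_conjTranspose, Matrix.one_mul]
  refine ⟨x, ?_, h1⟩
  have hs : ∀ a, (Matrix.diagonal (fun r => (n r a : ℂ)))ᴴ = Matrix.diagonal (fun r => (n r a : ℂ)) :=
    fun a => by
      rw [Matrix.diagonal_conjTranspose]
      congr 1
      funext r
      simp
  rw [← hA.left_sum]
  have h3 : ∀ a, (A a)ᴴ * A a =
      xᴴ * (Matrix.diagonal (fun r => (n r a : ℂ) * (n r a : ℂ)) * x) := fun a => by
    rw [h1 a, Matrix.conjTranspose_mul, Matrix.mul_assoc, ← Matrix.mul_assoc gᴴ, h.unitary,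
      Matrix.one_mul, Matrix.conjTranspose_mul, hs, Matrix.mul_assoc, ← Matrix.mul_assoc
      (Matrix.diagonal _) (Matrix.diagonal _), Matrix.diagonal_mul_diagonal]
  simp only [h3]
  rw [← Matrix.mul_sum, ← Matrix.sum_mul]
  have h4 : ∑ a, Matrix.diagonal (fun r => (n r a : ℂ) * (n r a : ℂ)) = 1 := by
    ext r s
    rw [Matrix.sum_apply]
    by_cases hrs : r = s
    · subst hrs
      simp only [Matrix.diagonal_apply_eq, Matrix.one_apply_eq]
      have := h.unit r
      rw [dotProduct] at this
      exact_mod_cast this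
    · simp [Matrix.diagonal_apply_ne _ hrs, Matrix.one_apply_ne hrs]
  rw [h4, Matrix.one_mul]

lemma sum_gram_mul_gram (h : ∑ s, (A s)ᴴ * B s = 0) (c d : Fin 3) :
    ∑ b, A c * (A b)ᴴ * (B b * (B d)ᴴ) = 0 := by
  have : ∑ b, A c * (A b)ᴴ * (B b * (B d)ᴴ) = A c * (∑ b, (A b)ᴴ * B b) * (B d)ᴴ := by
    simp only [Matrix.mul_sum, Matrix.sum_mul, Matrix.mul_assoc]
  rw [this, h]
  simp

lemma sum_conjTranspose_mul_symm (h : ∑ s, (A s)ᴴ * B s = 0) : ∑ s, (B s)ᴴ * A s = 0 := by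
  have := congrArg Matrix.conjTranspose h
  simpa [Matrix.conjTranspose_sum, Matrix.conjTranspose_mul] using this

lemma sum_dotProduct_eq_zero_of_forall {n : Fin 3 → ℝ} (hn : n ⬝ᵥ n = 1) {y : Fin 3 → ℂ}
    (h : ∀ c, ∑ b, (n c : ℂ) * n b * y b = 0) : ∑ b, y b * n b = 0 := by
  have hn' : ((n 0 : ℂ) * n 0 + n 1 * n 1 + n 2 * n 2) = 1 := by
    simp only [dotProduct, Fin.sum_univ_three] at hn
    exact_mod_cast hn
  simp only [Fin.sum_univ_three] at h ⊢
  linear_combination n 0 * h 0 + n 1 * h 1 + n 2 * h 2 -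
    (n 0 * y 0 + n 1 * y 1 + n 2 * y 2) * hn'

/-- The products of two orthogonal triples commute with each other. -/
lemma IsUnitaryTriple.gram_commute_of_orthogonal (hA : IsUnitaryTriple A) (hB : IsUnitaryTriple B)
    (hAB : ∑ s, (A s)ᴴ * B s = 0) (a b c d : Fin 3) :
    A c * (A d)ᴴ * (B a * (B b)ᴴ) = B a * (B b)ᴴ * (A c * (A d)ᴴ) := by
  obtain ⟨g, D, hg, hD⟩ := exists_unitary_simultaneous_diagonal
    (fun p : Fin 3 × Fin 3 => A p.1 * (A p.2)ᴴ) (fun p => hA.gram_isHermitian p.1 p.2)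
    (fun p q => hA.gram_commute p.1 p.2 q.1 q.2)
  obtain ⟨n, hn⟩ := hA.exists_isGramFrame g hg (fun a b => D (a, b)) (fun a b => hD (a, b))
  have hg' := hn.mul_conjTranspose
  -- The products of `B` in the eigenbasis of those of `A`. For fixed `s`, `s'` their entries form a
  -- symmetric 3 × 3 matrix annihilated by `n s` and `n s'`, and traceless if `s ≠ s'`, so
  -- `symm_traceless_mul_sub_eq_zero` kills the commutator.
  let Z : Fin 3 → Fin 3 → Matrix (Fin k) (Fin k) ℂ := fun a b => gᴴ * (B a * (B b)ᴴ) * g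
  have hcomp : ∀ P Q : Matrix (Fin k) (Fin k) ℂ, gᴴ * (P * Q) * g = (gᴴ * P * g) * (gᴴ * Q * g) := by
    intro P Q
    calc gᴴ * (P * Q) * g = gᴴ * P * 1 * Q * g := by simp only [Matrix.mul_assoc, Matrix.one_mul]
      _ = _ := by rw [← hg']; simp only [Matrix.mul_assoc]
  have hl : ∀ s s' b, ∑ a, Z a b s s' * n s a = 0 := fun s s' d => by
    apply sum_dotProduct_eq_zero_of_forall (hn.unit s)
    intro c
    have h1 : gᴴ * (∑ b, A c * (A b)ᴴ * (B b * (B d)ᴴ)) * g = 0 := by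
      rw [sum_gram_mul_gram hAB]; simp
    rw [Matrix.mul_sum, Matrix.sum_mul] at h1
    simp only [fun a b c d => hcomp (A a * (A b)ᴴ) (B c * (B d)ᴴ), hn.diag] at h1
    have := congrFun (congrFun h1 s) s'
    simp only [Matrix.sum_apply, Matrix.diagonal_mul, Matrix.zero_apply] at this
    exact this
  have hZs : ∀ a b, Z a b = Z b a := fun a b => by simp only [Z, hB.right_swap a b]
  have hr : ∀ s s' b, ∑ a, Z a b s s' * n s' a = 0 := fun s s' d => by
    apply sum_dotProduct_eq_zero_of_forall (hn.unit s')
    intro c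
    have h1 : gᴴ * (∑ b, B d * (B b)ᴴ * (A b * (A c)ᴴ)) * g = 0 := by
      rw [sum_gram_mul_gram (sum_conjTranspose_mul_symm hAB)]; simp
    rw [Matrix.mul_sum, Matrix.sum_mul] at h1
    simp only [fun a b c d => hcomp (B a * (B b)ᴴ) (A c * (A d)ᴴ), hn.diag] at h1
    have := congrFun (congrFun h1 s) s'
    simp only [Matrix.sum_apply, Matrix.mul_diagonal, Matrix.zero_apply] at this
    rw [← this]
    refine Finset.sum_congr rfl fun b _ => ?_
    rw [hZs b d]
    simp only [Z]
    ring
  have htr : ∑ a, Z a a = 1 := by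
    simp only [Z]
    rw [← Matrix.sum_mul, ← Matrix.mul_sum, hB.right_sum, Matrix.mul_one, hg]
  have hcomm : (gᴴ * (A c * (A d)ᴴ) * g) * Z a b = Z a b * (gᴴ * (A c * (A d)ᴴ) * g) := by
    rw [hn.diag]
    ext s s'
    rw [Matrix.diagonal_mul, Matrix.mul_diagonal]
    by_cases hss : s = s'
    · subst hss
      ring
    · have h0 : ∑ a, Z a a s s' = 0 := by
        rw [← Matrix.sum_apply, htr, Matrix.one_apply_ne hss]
      have := symm_traceless_mul_sub_eq_zero (fun a b => Z a b s s')
        (fun a b => by rw [hZs]) h0 (n s) (n s') (hn.unit s) (hn.unit s') (hl s s') (hr s s') a b c d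
      linear_combination -this
  simp only [Z] at hcomm
  rw [← hcomp, ← hcomp] at hcomm
  have hback : ∀ P : Matrix (Fin k) (Fin k) ℂ, g * (gᴴ * P * g) * gᴴ = P := fun P => by
    calc _ = (g * gᴴ) * P * (g * gᴴ) := by simp only [Matrix.mul_assoc]
      _ = P := by rw [hg', Matrix.one_mul, Matrix.mul_one]
  rw [← hback (A c * (A d)ᴴ * (B a * (B b)ᴴ)), hcomm, hback]

/-- The diagonal entries of the vanishing sum are `n_c m_d (n · m)`, and unit vectors have nonzero
coordinates. -/
lemma IsGramFrame.dotProduct_eq_zero {g : Matrix (Fin k) (Fin k) ℂ} {n m : Fin k → Fin 3 → ℝ}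
    (hn : IsGramFrame A g n) (hm : IsGramFrame B g m) (hAB : ∑ s, (A s)ᴴ * B s = 0) (r : Fin k) :
    n r ⬝ᵥ m r = 0 := by
  have h1 : ∀ c d, (n r c : ℂ) * m r d * ∑ b, (n r b : ℂ) * m r b = 0 := fun c d => by
    have h1 : gᴴ * (∑ b, A c * (A b)ᴴ * (B b * (B d)ᴴ)) * g = 0 := by
      rw [sum_gram_mul_gram hAB]; simp
    have hcomp : ∀ P Q : Matrix (Fin k) (Fin k) ℂ,
        gᴴ * (P * Q) * g = (gᴴ * P * g) * (gᴴ * Q * g) := by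
      intro P Q
      calc gᴴ * (P * Q) * g = gᴴ * P * 1 * Q * g := by simp only [Matrix.mul_assoc, Matrix.one_mul]
        _ = _ := by rw [← hn.mul_conjTranspose]; simp only [Matrix.mul_assoc]
    rw [Matrix.mul_sum, Matrix.sum_mul] at h1
    simp only [fun a b c d => hcomp (A a * (A b)ᴴ) (B c * (B d)ᴴ), hn.diag, hm.diag, Matrix.diagonal_mul_diagonal] at h1
    have := congrFun (congrFun h1 r) r
    simp only [Matrix.sum_apply, Matrix.diagonal_apply_eq, Matrix.zero_apply] at this
    rw [← this, Finset.mul_sum]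
    exact Finset.sum_congr rfl fun b _ => by ring
  have hn1 := hn.unit r
  have hm1 := hm.unit r
  obtain ⟨c, hc⟩ : ∃ c, n r c ≠ 0 := by
    by_contra! h
    simp [dotProduct, h] at hn1
  obtain ⟨d, hd⟩ : ∃ d, m r d ≠ 0 := by
    by_contra! h
    simp [dotProduct, h] at hm1
  have := h1 c d
  rcases mul_eq_zero.1 this with h | h
  · rcases mul_eq_zero.1 h with h | h
    · exact absurd (by exact_mod_cast h) hc
    · exact absurd (by exact_mod_cast h) hd
  · rw [dotProduct]
    exact_mod_cast h

end Triples

/-! ### Common Pauli form of four orthogonal unitaries. -/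

lemma pauliSum_apply_of_factor {k : ℕ} {A : Fin 3 → Matrix (Fin k) (Fin k) ℂ}
    {g x : Matrix (Fin k) (Fin k) ℂ} {n : Fin k → Fin 3 → ℝ}
    (h : ∀ a, A a = g * (Matrix.diagonal (fun r => (n r a : ℂ)) * x)) (κ κ' : Fin k) (b a : Fin 2) :
    pauliSum A (κ, b) (κ', a) = ∑ r, g κ r * spin (n r) b a * x r κ' := by
  simp only [pauliSum, h, Matrix.sum_apply, Matrix.kroneckerMap_apply, Matrix.mul_apply (M := g),
    Matrix.diagonal_mul, spin, Matrix.smul_apply, smul_eq_mul, Finset.sum_mul, Finset.mul_sum]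
  rw [Finset.sum_comm]
  exact Finset.sum_congr rfl fun r _ => Finset.sum_congr rfl fun s _ => by ring

/-- Four orthogonal unitaries containing the identity are, in a suitable basis and up to right
multiplication by operators on the first factor, direct sums of rotated Pauli matrices. -/
lemma exists_common_pauli_form {k : ℕ}
    (u : Fin 4 → Matrix (Fin k × Fin 2) (Fin k × Fin 2) ℂ) (hu : ∀ i, (u i)ᴴ * u i = 1)
    (hu0 : u 0 = 1) (horth : ∀ i j, i ≠ j → qubitTrace ((u i)ᴴ * u j) = 0) :
    ∃ (g : Matrix (Fin k) (Fin k) ℂ) (S : Fin k → Matrix (Fin 2) (Fin 2) ℂ)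
      (x : Fin 4 → Matrix (Fin k) (Fin k) ℂ), gᴴ * g = 1 ∧
      (∀ r, S r ∈ Matrix.unitaryGroup (Fin 2) ℂ) ∧
      ∀ i κ b κ' a, u i (κ, b) (κ', a) =
        ∑ r, g κ r * (S r * pauli i * (S r)ᴴ) b a * x i r κ' := by
  have htr : ∀ i, i ≠ 0 → qubitTrace (u i) = 0 := fun i hi => by
    have := horth 0 i hi.symm
    rwa [hu0, Matrix.conjTranspose_one, Matrix.one_mul] at this
  obtain ⟨A, hA⟩ := exists_eq_pauliSum (u 1) (htr 1 (by decide))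
  obtain ⟨B, hB⟩ := exists_eq_pauliSum (u 2) (htr 2 (by decide))
  obtain ⟨C, hC⟩ := exists_eq_pauliSum (u 3) (htr 3 (by decide))
  have tA : IsUnitaryTriple A := isUnitaryTriple_of_unitary (by rw [← hA, hu])
  have tB : IsUnitaryTriple B := isUnitaryTriple_of_unitary (by rw [← hB, hu])
  have horth' : ∀ (X Y : Fin 3 → Matrix (Fin k) (Fin k) ℂ) i j, i ≠ j → u i = pauliSum X →
      u j = pauliSum Y → ∑ s, (X s)ᴴ * Y s = 0 := fun X Y i j hij hX hY => by
    have := horth i j hij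
    rw [hX, hY, conjTranspose_pauliSum, qubitTrace_pauliSum_mul] at this
    exact (smul_eq_zero.1 this).resolve_left two_ne_zero
  have hAB := horth' A B 1 2 (by decide) hA hB
  have hAC := horth' A C 1 3 (by decide) hA hC
  have hBC := horth' B C 2 3 (by decide) hB hC
  have hcross := tA.gram_commute_of_orthogonal tB hAB
  obtain ⟨g, D, hg, hD⟩ := exists_unitary_simultaneous_diagonal
    (fun p : Bool × Fin 3 × Fin 3 =>
      if p.1 then A p.2.1 * (A p.2.2)ᴴ else B p.2.1 * (B p.2.2)ᴴ)
    (by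
      rintro ⟨_ | _, a, b⟩
      · exact tB.gram_isHermitian a b
      · exact tA.gram_isHermitian a b)
    (by
      rintro ⟨_ | _, a, b⟩ ⟨_ | _, c, d⟩
      · exact tB.gram_commute a b c d
      · exact (hcross a b c d).symm
      · exact hcross c d a b
      · exact tA.gram_commute a b c d)
  obtain ⟨n, hn⟩ := tA.exists_isGramFrame g hg (fun a b => D (true, a, b))
    (fun a b => hD (true, a, b))
  obtain ⟨m, hm⟩ := tB.exists_isGramFrame g hg (fun a b => D (false, a, b))
    (fun a b => hD (false, a, b))
  have hg' := hn.mul_conjTranspose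
  have hnm := hn.dotProduct_eq_zero hm hAB
  obtain ⟨xA, hxA, hfA⟩ := hn.exists_factor tA
  obtain ⟨xB, hxB, hfB⟩ := hm.exists_factor tB
  -- Since `x` is invertible, orthogonality to `C` becomes a condition on each row of `gᴴ * C`
  -- separately.
  have hzero : ∀ (X : Fin 3 → Matrix (Fin k) (Fin k) ℂ) (v : Fin k → Fin 3 → ℝ) x, xᴴ * x = 1 →
      (∀ a, X a = g * (Matrix.diagonal (fun r => (v r a : ℂ)) * x)) → ∑ s, (X s)ᴴ * C s = 0 →
      ∀ r κ', ∑ a, (v r a : ℂ) * (gᴴ * C a) r κ' = 0 := fun X v x hx hX hXC r κ' => by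
    have h1 : ∀ s, (X s)ᴴ * C s = xᴴ * (Matrix.diagonal (fun r => (v r s : ℂ)) * (gᴴ * C s)) := by
      intro s
      rw [hX, Matrix.conjTranspose_mul, Matrix.conjTranspose_mul, Matrix.diagonal_conjTranspose,
        show star (fun r => (v r s : ℂ)) = fun r => (v r s : ℂ) from by funext r; simp]
      simp only [Matrix.mul_assoc]
    simp only [h1] at hXC
    rw [← Matrix.mul_sum] at hXC
    have hx' : x * xᴴ = 1 := mul_eq_one_comm.1 hx
    have h2 := congrArg (fun M => x * M) hXC
    simp only [← Matrix.mul_assoc x, hx', Matrix.one_mul, Matrix.mul_zero] at h2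
    have := congrFun (congrFun h2 r) κ'
    simpa [Matrix.sum_apply, Matrix.diagonal_mul] using this
  have hzA := hzero A n xA hxA hfA hAC
  have hzB := hzero B m xB hxB hfB hBC
  -- Row `r` of `gᴴ * C` is orthogonal to `n r` and `m r`; `xC` records its component along `n r ⨯₃
  -- m r`.
  let xC : Matrix (Fin k) (Fin k) ℂ :=
    ∑ b, Matrix.diagonal (fun r => (((n r) ⨯₃ (m r)) b : ℂ)) * (gᴴ * C b)
  have hfC : ∀ a, C a = g * (Matrix.diagonal (fun r => (((n r) ⨯₃ (m r)) a : ℂ)) * xC) := fun a => by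
    have h2 : gᴴ * C a = Matrix.diagonal (fun r => (((n r) ⨯₃ (m r)) a : ℂ)) * xC := by
      ext r κ'
      rw [Matrix.diagonal_mul]
      simp only [xC, Matrix.sum_apply, Matrix.diagonal_mul]
      have e : ∀ b, ((n r a * n r b + m r a * m r b + (n r ⨯₃ m r) a * (n r ⨯₃ m r) b : ℝ) : ℂ) =
          if a = b then 1 else 0 := fun b => by
        rw [orthonormal_frame_complete (n r) (m r) (hn.unit r) (hm.unit r) (hnm r) a b]
        split_ifs <;> simp
      have h3 : (gᴴ * C a) r κ' = ∑ b, (if a = b then 1 else 0) * (gᴴ * C b) r κ' := by simp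
      rw [h3]
      simp only [← e]
      have z1 := hzA r κ'
      have z2 := hzB r κ'
      simp only [Fin.sum_univ_three] at z1 z2 ⊢
      push_cast
      linear_combination n r a * z1 + m r a * z2
    rw [← h2, ← Matrix.mul_assoc, hg', Matrix.one_mul]
  choose S hS hS1 hS2 hS3 using fun r =>
    exists_unitary_conj_pauli (n r) (m r) (hn.unit r) (hm.unit r) (hnm r)
  refine ⟨g, S, ![gᴴ, xA, xB, xC], hg, hS, fun i κ b κ' a => ?_⟩
  fin_cases i
  · have h1 : ∀ r, S r * pauli 0 * (S r)ᴴ = 1 := fun r => by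
      have : pauli 0 = 1 := rfl
      rw [this, Matrix.mul_one]
      exact Matrix.mem_unitaryGroup_iff.1 (hS r)
    have h2 := congrFun (congrFun hg' κ) κ'
    simp only [Matrix.mul_apply, Matrix.one_apply] at h2
    simp only [Fin.zero_eta, hu0, h1]
    by_cases hba : b = a
    · subst hba
      simpa [Matrix.one_apply] using h2.symm
    · simp [hba]
  · simp only [Fin.mk_one, hS1, hA]
    exact pauliSum_apply_of_factor hfA κ κ' b a
  · simp only [Fin.reduceFinMk, hS2, hB]
    exact pauliSum_apply_of_factor hfB κ κ' b a
  · simp only [Fin.reduceFinMk, hS3, hC]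
    exact pauliSum_apply_of_factor (n := fun r => n r ⨯₃ m r) hfC κ κ' b a

/-! ### Perfect discrimination and the normal form of the amplitudes. -/

lemma exists_eq_conjTranspose_mul_self {ι : Type*} [Fintype ι] [DecidableEq ι] {M : Matrix ι ι ℂ}
    (hM : M.PosSemidef) : ∃ K : Matrix ι ι ℂ, M = Kᴴ * K := by
  open scoped MatrixOrder in
  obtain ⟨a, ha⟩ := CStarAlgebra.nonneg_iff_eq_star_mul_self.mp hM.nonneg
  exact ⟨a, ha⟩

/-- States that a POVM discriminates perfectly have orthogonal column spaces. -/
lemma conjTranspose_mul_eq_zero_of_discriminated {ι κ c : Type*} [Fintype ι] [DecidableEq ι]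
    [Fintype κ] [Fintype c] {M : κ → Matrix ι ι ℂ} (hM : IsPOVM M)
    (N : κ → Matrix ι c ℂ) (htr : ∀ i, (N i * (N i)ᴴ).trace = 1)
    (hdec : ∀ i, 1 ≤ (M i * (N i * (N i)ᴴ)).trace.re) (i j : κ) (hij : i ≠ j) :
    (N i)ᴴ * N j = 0 := by
  classical
  have hcyc : ∀ i j, (M j * (N i * (N i)ᴴ)).trace = ((N i)ᴴ * M j * N i).trace := fun i j => by
    rw [← Matrix.mul_assoc, Matrix.trace_mul_comm, Matrix.mul_assoc]
  have hpos : ∀ i j, ((N i)ᴴ * M j * N i).PosSemidef := fun i j =>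
    (hM.posSemidef j).conjTranspose_mul_mul_same (N i)
  have hnn : ∀ i j, 0 ≤ (M j * (N i * (N i)ᴴ)).trace := fun i j => by
    rw [hcyc]; exact (hpos i j).trace_nonneg
  have hsum : ∀ i, ∑ j, (M j * (N i * (N i)ᴴ)).trace.re = 1 := fun i => by
    rw [← Complex.re_sum, ← Matrix.trace_sum, ← Matrix.sum_mul, hM.sum_eq_one, Matrix.one_mul, htr]
    simp
  -- Outcome `i` exhausts the probability on state `i`, leaving zero for every other outcome.
  have hMN : ∀ i j, j ≠ i → M j * N i = 0 := fun i j hji => by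
    have h1 : ∑ l ∈ Finset.univ.erase i, (M l * (N i * (N i)ᴴ)).trace.re ≤ 0 := by
      have := Finset.add_sum_erase Finset.univ (fun l => (M l * (N i * (N i)ᴴ)).trace.re)
        (Finset.mem_univ i)
      linarith [hsum i, hdec i]
    have h2 : (M j * (N i * (N i)ᴴ)).trace.re ≤ 0 :=
      (Finset.single_le_sum (f := fun l => (M l * (N i * (N i)ᴴ)).trace.re)
        (fun l _ => (Complex.le_def.1 (hnn i l)).1) (by simp [hji])).trans h1
    have h3 : (M j * (N i * (N i)ᴴ)).trace = 0 := by
      have := Complex.le_def.1 (hnn i j)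
      apply Complex.ext
      · exact le_antisymm h2 this.1
      · exact this.2.symm
    rw [hcyc] at h3
    obtain ⟨K, hK⟩ := exists_eq_conjTranspose_mul_self (hM.posSemidef j)
    have h4 : K * N i = 0 := by
      rw [← Matrix.trace_conjTranspose_mul_self_eq_zero_iff, ← h3, hK, Matrix.conjTranspose_mul]
      simp only [Matrix.mul_assoc]
    rw [hK, Matrix.mul_assoc, h4, Matrix.mul_zero]
  -- In the inserted resolution of the identity, `M l` kills `N j` unless `l = j`, and then it kills
  -- `N i`.
  have h5 : (N i)ᴴ * N j = ∑ l, (N i)ᴴ * (M l * N j) := by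
    rw [← Matrix.mul_sum, ← Matrix.sum_mul, hM.sum_eq_one, Matrix.one_mul]
  rw [h5]
  refine Finset.sum_eq_zero fun l _ => ?_
  by_cases hl : l = j
  · have h6 : (N i)ᴴ * M l = 0 := by
      have := congrArg Matrix.conjTranspose (hMN i l (by rw [hl]; exact hij.symm))
      rwa [Matrix.conjTranspose_mul, (hM.posSemidef l).isHermitian.eq, Matrix.conjTranspose_zero]
        at this
    rw [← Matrix.mul_assoc, h6, Matrix.zero_mul]
  · rw [hMN j l hl, Matrix.mul_zero]

lemma conj_pauli_mul_self {S : Matrix (Fin 2) (Fin 2) ℂ} (hS : S ∈ Matrix.unitaryGroup (Fin 2) ℂ)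
    (i : Fin 4) : (S * pauli i * Sᴴ)ᴴ = S * pauli i * Sᴴ ∧
      (S * pauli i * Sᴴ) * (S * pauli i * Sᴴ) = 1 := by
  have h1 : S * Sᴴ = 1 := Matrix.mem_unitaryGroup_iff.1 hS
  have h2 : Sᴴ * S = 1 := Matrix.mem_unitaryGroup_iff'.1 hS
  have h3 : pauli i * pauli i = 1 := by
    fin_cases i <;> ext a b <;> fin_cases a <;> fin_cases b <;> simp [pauli]
  constructor
  · simp [Matrix.conjTranspose_mul, conjTranspose_pauli, Matrix.mul_assoc]
  · calc _ = S * (pauli i * (Sᴴ * S) * pauli i) * Sᴴ := by simp only [Matrix.mul_assoc]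
      _ = 1 := by rw [h2, Matrix.mul_one, h3, Matrix.mul_one, h1]

/-- The joint normal form of Bob's conditional amplitudes. -/
lemma exists_pauli_amplitudes {β c : Type*} [Fintype β] [DecidableEq β] [Fintype c] [DecidableEq c]
    (N : Fin 4 → Matrix (Fin 2 × β) c ℂ) (ω : Matrix β β ℂ)
    (horth : ∀ i j, i ≠ j → (N i)ᴴ * N j = 0) (hmarg : ∀ i, flat (N i) * (flat (N i))ᴴ = ω) :
    ∃ (k : ℕ) (J : Matrix β (Fin k × Fin 2) ℂ) (S : Fin k → Matrix (Fin 2) (Fin 2) ℂ)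
      (χ : Fin 4 → Matrix (Fin k) c ℂ), Jᴴ * J = 1 ∧
      (∀ r, S r ∈ Matrix.unitaryGroup (Fin 2) ℂ) ∧
      ∀ i a b y, N i (a, b) y = ((Real.sqrt 2 : ℂ))⁻¹ *
        ∑ p : Fin k × Fin 2, J b p * ((S p.1 * pauli i * (S p.1)ᴴ) a p.2 * χ i p.1 y) := by
  obtain ⟨k, J, u, B, hJ, hu, hu0, huo, hN⟩ := exists_unitaries_of_orthogonal N ω horth hmarg
  -- `flat` makes A'' a column index, so the Pauli blocks would come out transposed. Conjugating
  -- before and after, with Hermiticity of the blocks, corrects this.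
  let cj : ∀ {m n : Type}, Matrix m n ℂ → Matrix m n ℂ := fun M => M.map (starRingEnd ℂ)
  have hcj : ∀ i j, (cj (u i))ᴴ * cj (u j) = cj ((u i)ᴴ * u j) := fun i j => by
    simp only [cj, Matrix.map_mul]
    congr 1
  obtain ⟨g, S, x, hg, hS, hx⟩ := exists_common_pauli_form (fun i => cj (u i))
    (fun i => by rw [hcj, hu]; simp [cj]) (by simp [hu0, cj])
    (fun i j hij => by
      rw [hcj]
      ext κ κ'
      have := congrArg (starRingEnd ℂ) (congrFun (congrFun (huo i j hij) κ) κ')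
      simpa [qubitTrace, cj] using this)
  refine ⟨k, J * (cj g ⊗ₖ (1 : Matrix (Fin 2) (Fin 2) ℂ)), S, fun i => cj (x i) * B i, ?_, hS, ?_⟩
  · have hgg : (cj g)ᴴ * cj g = 1 := by
      have : (cj g)ᴴ * cj g = cj (gᴴ * g) := by
        simp only [cj, Matrix.map_mul]
        congr 1
      rw [this, hg]; simp [cj]
    rw [Matrix.conjTranspose_mul, Matrix.mul_assoc, ← Matrix.mul_assoc Jᴴ, hJ, Matrix.one_mul,
      Matrix.conjTranspose_kronecker, ← Matrix.mul_kronecker_mul, hgg]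
    simp
  · intro i a b y
    have hu' : ∀ κ b κ' a, u i (κ, b) (κ', a) =
        ∑ r, cj g κ r * ((S r * pauli i * (S r)ᴴ) a b * cj (x i) r κ') := fun κ b κ' a => by
      have := congrArg (starRingEnd ℂ) (hx i κ b κ' a)
      simp only [cj, Matrix.map_apply, Complex.conj_conj, map_sum, map_mul] at this
      rw [this]
      refine Finset.sum_congr rfl fun r _ => ?_
      have h1 : (starRingEnd ℂ) ((S r * pauli i * (S r)ᴴ) b a) = (S r * pauli i * (S r)ᴴ) a b := by
        conv_rhs => rw [← (conj_pauli_mul_self (hS r) i).1]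
        rw [Matrix.conjTranspose_apply, Complex.star_def]
      rw [h1, mul_assoc]
      rfl
    let D : Matrix (Fin k × Fin 2) (Fin k × Fin 2) ℂ := Matrix.of fun p q =>
      if p.1 = q.1 then (S p.1 * pauli i * (S p.1)ᴴ) q.2 p.2 else 0
    have hD : u i = (cj g ⊗ₖ (1 : Matrix (Fin 2) (Fin 2) ℂ)) *
        (D * (cj (x i) ⊗ₖ (1 : Matrix (Fin 2) (Fin 2) ℂ))) := by
      ext ⟨κ, b⟩ ⟨κ', a⟩
      rw [hu']
      simp [Matrix.mul_apply (M := cj g ⊗ₖ _), Matrix.mul_apply (M := D), Fintype.sum_prod_type, D,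
        Matrix.one_apply, ite_mul]
    have h1 : N i (a, b) y = flat (N i) b (y, a) := rfl
    rw [h1, hN, hD, Matrix.smul_apply, smul_eq_mul]
    congr 1
    have h2 : J * ((cj g ⊗ₖ (1 : Matrix (Fin 2) (Fin 2) ℂ)) *
        (D * (cj (x i) ⊗ₖ (1 : Matrix (Fin 2) (Fin 2) ℂ)))) *
          (B i ⊗ₖ (1 : Matrix (Fin 2) (Fin 2) ℂ)) =
        (J * (cj g ⊗ₖ (1 : Matrix (Fin 2) (Fin 2) ℂ))) *
          (D * ((cj (x i) * B i) ⊗ₖ (1 : Matrix (Fin 2) (Fin 2) ℂ))) := by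
      rw [show ((cj (x i) * B i) ⊗ₖ (1 : Matrix (Fin 2) (Fin 2) ℂ)) =
        (cj (x i) ⊗ₖ (1 : Matrix (Fin 2) (Fin 2) ℂ)) * (B i ⊗ₖ (1 : Matrix (Fin 2) (Fin 2) ℂ)) by
          rw [← Matrix.mul_kronecker_mul, Matrix.one_mul]]
      simp only [Matrix.mul_assoc]
    rw [h2, Matrix.mul_apply]
    refine Finset.sum_congr rfl fun p _ => ?_
    congr 1
    rw [Matrix.mul_apply]
    simp [Fintype.sum_prod_type, D, Matrix.one_apply, ite_mul]

/-! ### Alice's side: projectors and local corrections. -/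

section Alice

variable {α ε : Type*} [Fintype α] [DecidableEq α] [Fintype ε] [DecidableEq ε] {k : ℕ}

/-- `T i` preserves Gram matrices, so each entry of `(φ r)ᴴ * φ s`, times the identity, is a
multiple of a product of two rotated Paulis. A nonzero entry forces these to be proportional for
every `i`. -/
lemma exists_projectiveMeasurement_of_unitary [Nonempty (Fin k)]
    (T : Fin 4 → Matrix (α × Fin 2) (α × Fin 2) ℂ) (hT : ∀ i, (T i)ᴴ * T i = 1)
    (φ : Fin k → Matrix α ε ℂ) (χ : Fin 4 → Fin k → Matrix α ε ℂ)
    (S : Fin k → Matrix (Fin 2) (Fin 2) ℂ) (hS : ∀ r, S r ∈ Matrix.unitaryGroup (Fin 2) ℂ)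
    (h : ∀ i r, T i * (φ r ⊗ₖ (1 : Matrix (Fin 2) (Fin 2) ℂ)) =
      χ i r ⊗ₖ (S r * pauli i * (S r)ᴴ)) :
    ∃ (C : Fin 4 → Matrix α α ℂ) (P : Fin k → Matrix α α ℂ),
      (∀ i, C i ∈ Matrix.unitaryGroup α ℂ) ∧ IsProjectiveMeasurement P ∧
      ∀ i r, ((C i)ᴴ ⊗ₖ (1 : Matrix (Fin 2) (Fin 2) ℂ)) * T i *
          (φ r ⊗ₖ (1 : Matrix (Fin 2) (Fin 2) ℂ)) =
        (∑ s, P s ⊗ₖ (S s * pauli i * (S s)ᴴ)) * (φ r ⊗ₖ (1 : Matrix (Fin 2) (Fin 2) ℂ)) := by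
  classical
  let v : Fin 4 → Fin k → Matrix (Fin 2) (Fin 2) ℂ := fun i r => S r * pauli i * (S r)ᴴ
  have hvs : ∀ i r, (v i r)ᴴ = v i r := fun i r => (conj_pauli_mul_self (hS r) i).1
  have hvv : ∀ i r, v i r * v i r = 1 := fun i r => (conj_pauli_mul_self (hS r) i).2
  -- Only indices with different frames up to scalars have orthogonal amplitudes, so the projectors
  -- must belong to classes of indices.
  let R : Setoid (Fin k) :=
    { r := fun r s => ∀ i, ∃ z : ℂ, z ≠ 0 ∧ v i r = z • v i s
      iseqv :=
        { refl := fun r i => ⟨1, one_ne_zero, by simp⟩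
          symm := fun {r s} hrs i => by
            obtain ⟨z, hz, hv⟩ := hrs i
            exact ⟨z⁻¹, inv_ne_zero hz, by rw [hv, smul_smul, inv_mul_cancel₀ hz, one_smul]⟩
          trans := fun {r s t} hrs hst i => by
            obtain ⟨z, hz, hv⟩ := hrs i
            obtain ⟨w, hw, hv'⟩ := hst i
            exact ⟨z * w, mul_ne_zero hz hw, by rw [hv, hv', smul_smul]⟩ } }
  let f : Fin k → Fin k := fun r => (Quotient.mk R r).out
  have hf : ∀ r i, ∃ z : ℂ, v i r = z • v i (f r) := fun r i => by
    obtain ⟨z, -, hz⟩ := R.symm (Quotient.mk_out (s := R) r) i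
    exact ⟨z, hz⟩
  have hfne : ∀ r s, f r ≠ f s → ∃ i, ∀ z : ℂ, z ≠ 0 → v i r ≠ z • v i s := fun r s hrs => by
    by_contra! hcon
    exact hrs (congrArg Quotient.out (Quotient.sound (s := R) hcon))
  have hgram : ∀ i (x y : Matrix α ε ℂ) (p q : Matrix α ε ℂ) (w w' : Matrix (Fin 2) (Fin 2) ℂ),
      T i * (x ⊗ₖ (1 : Matrix (Fin 2) (Fin 2) ℂ)) = p ⊗ₖ w →
      T i * (y ⊗ₖ (1 : Matrix (Fin 2) (Fin 2) ℂ)) = q ⊗ₖ w' →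
      ∀ e e', (xᴴ * y) e e' • (1 : Matrix (Fin 2) (Fin 2) ℂ) = (pᴴ * q) e e' • (wᴴ * w') := by
    intro i x y p q w w' hx hy e e'
    have h1 : (xᴴ * y) ⊗ₖ (1 : Matrix (Fin 2) (Fin 2) ℂ) = (pᴴ * q) ⊗ₖ (wᴴ * w') := by
      rw [Matrix.mul_kronecker_mul, ← Matrix.conjTranspose_kronecker, ← hx, ← hy,
        Matrix.conjTranspose_mul, Matrix.mul_assoc, ← Matrix.mul_assoc (T i)ᴴ, hT, Matrix.one_mul,
        Matrix.conjTranspose_kronecker, ← Matrix.mul_kronecker_mul]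
      simp
    ext a b
    exact congrFun (congrFun h1 (e, a)) (e', b)
  have hφ : ∀ r s, f r ≠ f s → (φ r)ᴴ * φ s = 0 := fun r s hrs => by
    obtain ⟨i, hi⟩ := hfne r s hrs
    ext e e'
    have h1 := hgram i _ _ _ _ _ _ (h i r) (h i s) e e'
    rw [Matrix.zero_apply]
    by_contra hne
    have h2 : ((χ i r)ᴴ * χ i s) e e' ≠ 0 := fun h0 => by
      rw [h0, zero_smul] at h1
      exact hne ((smul_eq_zero.1 h1).resolve_right one_ne_zero)
    change _ = _ • ((v i r)ᴴ * v i s) at h1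
    have h3 := congrArg (fun M => v i r * M) h1
    simp only [Matrix.mul_smul, hvs, ← Matrix.mul_assoc, hvv, Matrix.one_mul, Matrix.mul_one] at h3
    refine hi ((((φ r)ᴴ * φ s) e e')⁻¹ * ((χ i r)ᴴ * χ i s) e e')
      (mul_ne_zero (inv_ne_zero hne) h2) ?_
    rw [← smul_smul, ← h3, smul_smul, inv_mul_cancel₀ hne, one_smul]
  choose z hz using hf
  -- The scalar between a rotated Pauli and its class representative is moved into the A' amplitude.
  let χ' : Fin 4 → Fin k → Matrix α ε ℂ := fun i r => z r i • χ i r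
  have h' : ∀ i r, T i * (φ r ⊗ₖ (1 : Matrix (Fin 2) (Fin 2) ℂ)) = χ' i r ⊗ₖ v i (f r) :=
    fun i r => by
      rw [h]
      change χ i r ⊗ₖ v i r = _
      rw [hz r i]
      simp only [χ', Matrix.smul_kronecker, Matrix.kronecker_smul]
  have hχ : ∀ i r s, (φ r)ᴴ * φ s = (χ' i r)ᴴ * χ' i s := fun i r s => by
    ext e e'
    have h1 := hgram i _ _ _ _ _ _ (h' i r) (h' i s) e e'
    by_cases hrs : f r = f s
    · rw [hrs, hvs, hvv] at h1
      simpa using congrFun (congrFun h1 0) 0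
    · rw [hφ r s hrs, Matrix.zero_apply, zero_smul] at h1
      rw [hφ r s hrs, Matrix.zero_apply]
      refine ((smul_eq_zero.1 h1.symm).resolve_right fun h0 => ?_).symm
      have h2 : v i (f r) * ((v i (f r))ᴴ * v i (f s)) * v i (f s) = 1 := by
        rw [hvs, ← Matrix.mul_assoc (v i (f r)) (v i (f r)), hvv, Matrix.one_mul, hvv]
      rw [h0] at h2
      simp at h2
  have hC : ∀ i, ∃ C ∈ Matrix.unitaryGroup α ℂ, ∀ r, C * φ r = χ' i r := fun i => by
    -- Side by side, the blocks have a single Gram matrix, so one `C` serves all `r`.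
    let stack : (Fin k → Matrix α ε ℂ) → Matrix α (Fin k × ε) ℂ := fun X =>
      Matrix.of fun a p => X p.1 a p.2
    obtain ⟨C, hC, hCX⟩ := exists_unitary_mul_eq (stack φ) (stack (χ' i)) (by
      ext ⟨r, e⟩ ⟨s, e'⟩
      exact congrFun (congrFun (hχ i r s) e) e')
    refine ⟨C, hC, fun r => ?_⟩
    ext a e
    exact congrFun (congrFun hCX a) (r, e)
  choose C hC hCφ using hC
  obtain ⟨P, hP, hPφ⟩ := exists_projectiveMeasurement φ f hφ
  refine ⟨C, P, hC, hP, fun i r => ?_⟩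
  have h1 : (C i)ᴴ * χ' i r = φ r := by
    rw [← hCφ, ← Matrix.mul_assoc]
    have := Matrix.mem_unitaryGroup_iff'.1 (hC i)
    rw [Matrix.star_eq_conjTranspose] at this
    rw [this, Matrix.one_mul]
  rw [Matrix.mul_assoc, h', ← Matrix.mul_kronecker_mul, h1, Matrix.one_mul, Matrix.sum_mul,
    Finset.sum_eq_single (f r)]
  · rw [← Matrix.mul_kronecker_mul, hPφ, Matrix.mul_one]
  · intro s _ hs
    rw [← Matrix.mul_kronecker_mul, ← hPφ r, ← Matrix.mul_assoc, hP.orthogonal s (f r) hs]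
    simp
  · simp

end Alice

/-! ### Amplitudes of the purified protocol. -/

section Amplitudes

variable {α β ε : Type*} [Fintype α]

/-- Alice's conditional amplitude given Bob's basis state `b`. -/
def slice (Ψ : Matrix ((α × Fin 2) × β) ε ℂ) (b : β) : Matrix (α × Fin 2) ε ℂ :=
  Matrix.of fun x e => Ψ (x, b) e

/-- The amplitudes on `A'' ⊗ B` after Alice has applied `U`, against those of `A'` and the
purifying system. -/
def received (U : Matrix (α × Fin 2) (α × Fin 2) ℂ) (Ψ : Matrix ((α × Fin 2) × β) ε ℂ) :
    Matrix (Fin 2 × β) (α × ε) ℂ :=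
  Matrix.of fun p q => (U * slice Ψ p.2) (q.1, p.1) q.2

lemma kronecker_one_mul_apply [Fintype β] [DecidableEq β] (U : Matrix (α × Fin 2) (α × Fin 2) ℂ)
    (Ψ : Matrix ((α × Fin 2) × β) ε ℂ) (x : α × Fin 2) (b : β) (e : ε) :
    ((U ⊗ₖ (1 : Matrix β β ℂ)) * Ψ) (x, b) e = (U * slice Ψ b) x e := by
  rw [Matrix.mul_apply, Matrix.mul_apply, Fintype.sum_prod_type]
  simp [slice, Matrix.one_apply, mul_ite, ite_mul]

lemma receivedState_mul_conjTranspose [Fintype β] [DecidableEq β] [Fintype ε]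
    (U : Matrix (α × Fin 2) (α × Fin 2) ℂ)
    (Ψ : Matrix ((α × Fin 2) × β) ε ℂ) :
    receivedState (Ψ * Ψᴴ) U = received U Ψ * (received U Ψ)ᴴ := by
  have h1 : (U ⊗ₖ (1 : Matrix β β ℂ)) * (Ψ * Ψᴴ) * (U ⊗ₖ (1 : Matrix β β ℂ))ᴴ =
      ((U ⊗ₖ (1 : Matrix β β ℂ)) * Ψ) * ((U ⊗ₖ (1 : Matrix β β ℂ)) * Ψ)ᴴ := by
    rw [Matrix.conjTranspose_mul]
    simp only [Matrix.mul_assoc]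
  ext ⟨a, b⟩ ⟨a', b'⟩
  rw [receivedState, h1]
  rw [partialTraceA', Matrix.of_apply, Matrix.mul_apply, Fintype.sum_prod_type]
  refine Finset.sum_congr rfl fun x _ => ?_
  rw [Matrix.mul_apply]
  refine Finset.sum_congr rfl fun e _ => ?_
  rw [Matrix.conjTranspose_apply, kronecker_one_mul_apply, kronecker_one_mul_apply]
  rfl

/-- Bob's marginal is blind to Alice's unitary: the right-hand side does not contain `U`. -/
lemma flat_received_mul_conjTranspose [DecidableEq α] [Fintype ε]
    {U : Matrix (α × Fin 2) (α × Fin 2) ℂ}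
    (hU : Uᴴ * U = 1) (Ψ : Matrix ((α × Fin 2) × β) ε ℂ) :
    flat (received U Ψ) * (flat (received U Ψ))ᴴ =
      Matrix.of fun b b' => (slice Ψ b * (slice Ψ b')ᴴ).trace := by
  ext b b'
  have h1 : (slice Ψ b * (slice Ψ b')ᴴ).trace = (U * slice Ψ b * (U * slice Ψ b')ᴴ).trace := by
    rw [Matrix.conjTranspose_mul, Matrix.mul_assoc, Matrix.trace_mul_comm U, Matrix.mul_assoc,
      Matrix.mul_assoc, hU, Matrix.mul_one]
  rw [Matrix.of_apply, h1, Matrix.mul_apply, Matrix.trace]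
  simp only [Matrix.diag_apply, Matrix.mul_apply (M := U * slice Ψ b), Fintype.sum_prod_type, flat,
    received, Matrix.of_apply, Matrix.conjTranspose_apply]
  exact Finset.sum_congr rfl fun a _ => Finset.sum_comm

lemma trace_received_mul_conjTranspose [DecidableEq α] [Fintype β] [Fintype ε]
    {U : Matrix (α × Fin 2) (α × Fin 2) ℂ}
    (hU : Uᴴ * U = 1) (Ψ : Matrix ((α × Fin 2) × β) ε ℂ) :
    (received U Ψ * (received U Ψ)ᴴ).trace = (Ψ * Ψᴴ).trace := by
  rw [← trace_flat_mul_conjTranspose, flat_received_mul_conjTranspose hU]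
  simp only [Matrix.trace, Matrix.diag_apply, Matrix.of_apply]
  rw [Fintype.sum_prod_type_right]
  rfl

end Amplitudes

lemma trace_tensorAcross_epr {α β : Type*} [Fintype α] [Fintype β]
    (ρ : Matrix (α × β) (α × β) ℂ) : (tensorAcross ρ epr).trace = ρ.trace := by
  have hs : (Real.sqrt 2 : ℂ) * (Real.sqrt 2 : ℂ) = 2 := by
    rw [← Complex.ofReal_mul, Real.mul_self_sqrt (by norm_num)]; simp
  have h1 : epr.trace = 1 := by
    simp [epr, Matrix.trace, Matrix.vecMulVec_apply, eprVec, Fintype.sum_prod_type]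
    rw [← mul_inv, hs]
    norm_num
  have h2 : (tensorAcross ρ epr).trace = (ρ ⊗ₖ epr).trace := by
    simp only [tensorAcross, Matrix.trace, Matrix.diag_apply, Matrix.submatrix_apply]
    exact Equiv.sum_comp (Equiv.prodProdProdComm α (Fin 2) β (Fin 2))
      (fun p => (ρ ⊗ₖ epr) p p)
  rw [h2, Matrix.trace_kronecker, h1, mul_one]

end SuperdenseCoding

/-! ### Assembly of the theorem. -/

open SuperdenseCoding

theorem theorem1p1 {α β : Type*} [Fintype α] [DecidableEq α] [Fintype β] [DecidableEq β]
    (τ : Matrix ((α × Fin 2) × β) ((α × Fin 2) × β) ℂ)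
    (U : Fin 4 → Matrix (α × Fin 2) (α × Fin 2) ℂ)
    (hτU : SuperdenseCoding.IsSuperdenseCodingProtocol τ U) :
    ∃ (V : Matrix (α × Fin 2) (α × Fin 2) ℂ) (C : Fin 4 → Matrix α α ℂ)
      (n : ℕ) (W : Matrix (Fin n × Fin 2) β ℂ)
      (ρ : Matrix (α × Fin n) (α × Fin n) ℂ)
      (m : ℕ) (P : Fin m → Matrix α α ℂ) (S : Fin m → Matrix (Fin 2) (Fin 2) ℂ)
      (τ' : Matrix ((α × Fin 2) × (Fin n × Fin 2)) ((α × Fin 2) × (Fin n × Fin 2)) ℂ),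
      V ∈ Matrix.unitaryGroup (α × Fin 2) ℂ ∧
      (∀ i, C i ∈ Matrix.unitaryGroup α ℂ) ∧
      Wᴴ * W = 1 ∧
      SuperdenseCoding.IsDensityMatrix ρ ∧
      SuperdenseCoding.IsProjectiveMeasurement P ∧
      (∀ r, S r ∈ Matrix.unitaryGroup (Fin 2) ℂ) ∧
      τ' = (V ⊗ₖ W) * τ * (V ⊗ₖ W)ᴴ ∧
      τ' = SuperdenseCoding.tensorAcross ρ SuperdenseCoding.epr ∧
      ∀ i, SuperdenseCoding.EqOnState τ'
        ((((C i)ᴴ ⊗ₖ (1 : Matrix (Fin 2) (Fin 2) ℂ)) * U i * Vᴴ) ⊗ₖ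
          (1 : Matrix (Fin n × Fin 2) (Fin n × Fin 2) ℂ))
        ((∑ r, P r ⊗ₖ (S r * SuperdenseCoding.pauli i * (S r)ᴴ)) ⊗ₖ
          (1 : Matrix (Fin n × Fin 2) (Fin n × Fin 2) ℂ)) := by
  obtain ⟨⟨hpsd, htr⟩, hU, M, hM, hdec⟩ := hτU
  obtain ⟨K, hK⟩ := exists_eq_conjTranspose_mul_self hpsd
  obtain ⟨Ψ, rfl⟩ : ∃ Ψ : Matrix ((α × Fin 2) × β) ((α × Fin 2) × β) ℂ, τ = Ψ * Ψᴴ :=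
    ⟨Kᴴ, by rw [hK, Matrix.conjTranspose_conjTranspose]⟩
  have hUU : ∀ i, (U i)ᴴ * U i = 1 := fun i => Matrix.mem_unitaryGroup_iff'.1 (hU i)
  have hUU' : ∀ i, U i * (U i)ᴴ = 1 := fun i => Matrix.mem_unitaryGroup_iff.1 (hU i)
  have horth := conjTranspose_mul_eq_zero_of_discriminated hM (fun i => received (U i) Ψ)
    (fun i => by rw [trace_received_mul_conjTranspose (hUU i), htr])
    (fun i => by rw [← receivedState_mul_conjTranspose]; exact hdec i)
  obtain ⟨k, J, S, χ, hJ, hS, hN⟩ := exists_pauli_amplitudes (fun i => received (U i) Ψ) _ horth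
    (fun i => flat_received_mul_conjTranspose (hUU i) Ψ)
  have hs : (Real.sqrt 2 : ℂ) * (Real.sqrt 2 : ℂ) = 2 := by
    rw [← Complex.ofReal_mul, Real.mul_self_sqrt (by norm_num)]; simp
  have hs0 : (Real.sqrt 2 : ℂ) ≠ 0 := fun h => by simp [h] at hs
  let X : Fin 4 → Fin k → Matrix α ((α × Fin 2) × β) ℂ := fun i r => Matrix.of fun a e => χ i r (a, e)
  have hslice : ∀ i b x e, (U i * slice Ψ b) x e = (Real.sqrt 2 : ℂ)⁻¹ *
      ∑ p : Fin k × Fin 2, J b p * ((S p.1 * pauli i * (S p.1)ᴴ) x.2 p.2 * X i p.1 x.1 e) :=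
    fun i b x e => hN i x.2 b (x.1, e)
  -- Alice's amplitude conditioned on Bob's vectors `J r`.
  let Θ : Fin k → Matrix (α × Fin 2) (((α × Fin 2) × β) × Fin 2) ℂ := fun r =>
    Matrix.of fun x p => ∑ b, Jᴴ (r, p.2) b * slice Ψ b x p.1
  have hΘ : ∀ i r, U i * Θ r = (Real.sqrt 2 : ℂ)⁻¹ • (X i r ⊗ₖ (S r * pauli i * (S r)ᴴ)) := by
    intro i r
    ext ⟨a', a⟩ ⟨e, b₂⟩
    have h1 : (U i * Θ r) (a', a) (e, b₂) =
        ∑ b, Jᴴ (r, b₂) b * (U i * slice Ψ b) (a', a) e := by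
      simp only [Matrix.mul_apply, Θ, Matrix.of_apply, Finset.mul_sum]
      rw [Finset.sum_comm]
      exact Finset.sum_congr rfl fun b _ => Finset.sum_congr rfl fun x _ => by ring
    have h2 : ∀ p, ∑ b, Jᴴ (r, b₂) b * J b p = if (r, b₂) = p then 1 else 0 := fun p => by
      rw [← Matrix.mul_apply, hJ, Matrix.one_apply]
    rw [h1]
    simp only [hslice, Finset.mul_sum]
    rw [Finset.sum_comm]
    have h3 : ∀ p : Fin k × Fin 2, (∑ b, Jᴴ (r, b₂) b * ((Real.sqrt 2 : ℂ)⁻¹ *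
        (J b p * ((S p.1 * pauli i * (S p.1)ᴴ) a p.2 * X i p.1 a' e)))) =
        (if (r, b₂) = p then 1 else 0) * ((Real.sqrt 2 : ℂ)⁻¹ *
          ((S p.1 * pauli i * (S p.1)ᴴ) a p.2 * X i p.1 a' e)) := fun p => by
      rw [← h2, Finset.sum_mul]
      exact Finset.sum_congr rfl fun b _ => by ring
    simp only [h3]
    simp only [ite_mul, one_mul, zero_mul, Finset.sum_ite_eq, Finset.mem_univ, if_true,
      Matrix.smul_apply, Matrix.kroneckerMap_apply, smul_eq_mul]
    ring
  have hv0 : ∀ r, S r * pauli 0 * (S r)ᴴ = 1 := fun r => by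
    rw [show pauli 0 = 1 from rfl, Matrix.mul_one]
    exact Matrix.mem_unitaryGroup_iff.1 (hS r)
  -- Message 0 has trivial Pauli part, so `U 0 * Θ r` is `X 0 r ⊗ₖ 1` up to √2; this eliminates `Θ
  -- r`.
  have hT : ∀ i r, (U i * (U 0)ᴴ) * (X 0 r ⊗ₖ (1 : Matrix (Fin 2) (Fin 2) ℂ)) =
      X i r ⊗ₖ (S r * pauli i * (S r)ᴴ) := fun i r => by
    have h0 := hΘ 0 r
    rw [hv0] at h0
    have h1 : X 0 r ⊗ₖ (1 : Matrix (Fin 2) (Fin 2) ℂ) = (Real.sqrt 2 : ℂ) • (U 0 * Θ r) := by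
      rw [h0, smul_smul, mul_inv_cancel₀ hs0, one_smul]
    rw [h1, Matrix.mul_smul, Matrix.mul_assoc, ← Matrix.mul_assoc (U 0)ᴴ, hUU, Matrix.one_mul, hΘ,
      smul_smul, mul_inv_cancel₀ hs0, one_smul]
  -- Bob's isometry.
  let n := k + Fintype.card β
  -- The first `k` coordinates of B' receive the range of `J`; the other `Fintype.card β` leave room
  -- for its complement in Bob's space.
  let ι : Matrix (Fin n × Fin 2) (Fin k × Fin 2) ℂ := Matrix.of fun p q =>
    if p = (Fin.castAdd _ q.1, q.2) then 1 else 0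
  have hι : ιᴴ * ι = 1 := by
    ext q q'
    simp only [Matrix.mul_apply, Matrix.conjTranspose_apply, ι, Matrix.of_apply, Matrix.one_apply]
    rw [Finset.sum_eq_single (Fin.castAdd _ q.1, q.2)]
    · simp [Prod.ext_iff]
    · intro p _ hp
      simp [hp]
    · simp
  obtain ⟨W, hW, hWJ⟩ := exists_isometry_mul_eq (m := Fin n × Fin 2) (by simp [n]; omega) J ι
    (by rw [hJ, hι])
  let Ψ' := (U 0 ⊗ₖ W) * Ψ
  let Φ : Matrix (α × Fin n) ((α × Fin 2) × β) ℂ := Matrix.of fun p e =>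
    ∑ r, if p.2 = Fin.castAdd _ r then X 0 r p.1 e else 0
  have hΨ' : ∀ x q e, Ψ' (x, q) e = (Real.sqrt 2 : ℂ)⁻¹ *
      ∑ r, (if q.1 = Fin.castAdd _ r then 1 else 0) *
        (X 0 r ⊗ₖ (1 : Matrix (Fin 2) (Fin 2) ℂ)) x (e, q.2) := by
    intro x q e
    have h1 : Ψ' (x, q) e = ∑ b, W q b * (U 0 * slice Ψ b) x e := by
      simp only [Ψ']
      rw [Matrix.mul_apply, Fintype.sum_prod_type_right]
      simp only [Matrix.kroneckerMap_apply, Matrix.mul_apply (M := U 0), Finset.mul_sum, slice,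
        Matrix.of_apply]
      exact Finset.sum_congr rfl fun b _ => Finset.sum_congr rfl fun y _ => by ring
    have h2 : ∀ p, ∑ b, W q b * J b p = ι q p := fun p => by rw [← Matrix.mul_apply, hWJ]
    rw [h1]
    simp only [hslice, hv0, Finset.mul_sum]
    rw [Finset.sum_comm]
    have h3 : ∀ p : Fin k × Fin 2, (∑ b, W q b * ((Real.sqrt 2 : ℂ)⁻¹ *
        (J b p * ((1 : Matrix (Fin 2) (Fin 2) ℂ) x.2 p.2 * X 0 p.1 x.1 e)))) =
        ι q p * ((Real.sqrt 2 : ℂ)⁻¹ *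
          ((1 : Matrix (Fin 2) (Fin 2) ℂ) x.2 p.2 * X 0 p.1 x.1 e)) := fun p => by
      rw [← h2, Finset.sum_mul]
      exact Finset.sum_congr rfl fun b _ => by ring
    simp only [h3]
    rw [Fintype.sum_prod_type]
    refine Finset.sum_congr rfl fun r _ => ?_
    rw [Finset.sum_eq_single q.2]
    · simp only [ι, Matrix.of_apply, Prod.ext_iff, and_true, Matrix.kroneckerMap_apply]
      ring
    · intro c _ hc
      simp [ι, Prod.ext_iff, hc.symm]
    · simp
  have hτ' : (U 0 ⊗ₖ W) * (Ψ * Ψᴴ) * (U 0 ⊗ₖ W)ᴴ = Ψ' * Ψ'ᴴ := by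
    simp only [Ψ', Matrix.conjTranspose_mul, Matrix.mul_assoc]
  have hΨΦ : ∀ x q e, Ψ' (x, q) e = (if x.2 = q.2 then (Real.sqrt 2 : ℂ)⁻¹ else 0) *
      Φ (x.1, q.1) e := by
    intro x q e
    rw [hΨ']
    simp only [Φ, Matrix.of_apply, Matrix.kroneckerMap_apply, Matrix.one_apply]
    split_ifs <;> simp
  have hepr : Ψ' * Ψ'ᴴ = tensorAcross (Φ * Φᴴ) epr := by
    ext ⟨x, q⟩ ⟨x', q'⟩
    simp only [tensorAcross, Matrix.submatrix_apply, Matrix.kroneckerMap_apply, Matrix.mul_apply,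
      Matrix.conjTranspose_apply, hΨΦ, epr, Matrix.vecMulVec_apply, eprVec,
      Equiv.prodProdProdComm_apply, Pi.star_apply, Finset.sum_mul]
    refine Finset.sum_congr rfl fun e _ => ?_
    simp only [star_mul', one_div]
    ring
  have htrρ : (Φ * Φᴴ).trace = 1 := by
    rw [← trace_tensorAcross_epr, ← hepr, ← hτ', Matrix.trace_mul_comm, ← Matrix.mul_assoc,
      Matrix.conjTranspose_kronecker, ← Matrix.mul_kronecker_mul, hUU, hW]
    simpa using htr
  -- With `k = 0` the state would vanish, against its trace one; some index is needed to carry the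
  -- leftover projector.
  have hk : Nonempty (Fin k) := by
    by_contra hne
    have : IsEmpty (Fin k) := not_nonempty_iff.1 hne
    have h0 : Φ = 0 := by
      ext p e
      simp [Φ]
    simp [h0] at htrρ
  have hTu : ∀ i, (U i * (U 0)ᴴ)ᴴ * (U i * (U 0)ᴴ) = 1 := fun i => by
    rw [Matrix.conjTranspose_mul, Matrix.conjTranspose_conjTranspose, Matrix.mul_assoc,
      ← Matrix.mul_assoc (U i)ᴴ, hUU, Matrix.one_mul, hUU']
  obtain ⟨C, P, hC, hP, hCP⟩ := exists_projectiveMeasurement_of_unitary _ hTu (X 0) X S hS hT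
  refine ⟨U 0, C, n, W, Φ * Φᴴ, k, P, S, _, hU 0, hC, hW,
    ⟨Matrix.posSemidef_self_mul_conjTranspose _, htrρ⟩, hP, hS, rfl, hτ'.trans hepr, fun i => ?_⟩
  rw [hτ']
  have hact : ∀ Y : Matrix (α × Fin 2) (α × Fin 2) ℂ, ∀ x q e,
      ((Y ⊗ₖ (1 : Matrix (Fin n × Fin 2) (Fin n × Fin 2) ℂ)) * Ψ') (x, q) e =
        (Real.sqrt 2 : ℂ)⁻¹ * ∑ r, (if q.1 = Fin.castAdd _ r then 1 else 0) *
          (Y * (X 0 r ⊗ₖ (1 : Matrix (Fin 2) (Fin 2) ℂ))) x (e, q.2) := by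
    intro Y x q e
    rw [kronecker_one_mul_apply, Matrix.mul_apply]
    simp only [slice, Matrix.of_apply, hΨ', Matrix.mul_apply (M := Y), Finset.mul_sum]
    rw [Finset.sum_comm]
    exact Finset.sum_congr rfl fun r _ => Finset.sum_congr rfl fun y _ => by ring
  have heq : ((((C i)ᴴ ⊗ₖ (1 : Matrix (Fin 2) (Fin 2) ℂ)) * U i * (U 0)ᴴ) ⊗ₖ
        (1 : Matrix (Fin n × Fin 2) (Fin n × Fin 2) ℂ)) * Ψ' =
      ((∑ r, P r ⊗ₖ (S r * pauli i * (S r)ᴴ)) ⊗ₖ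
        (1 : Matrix (Fin n × Fin 2) (Fin n × Fin 2) ℂ)) * Ψ' := by
    ext ⟨x, q⟩ e
    rw [hact, hact, Matrix.mul_assoc _ (U i)]
    simp only [hCP]
  have hconj : ∀ Y : Matrix ((α × Fin 2) × (Fin n × Fin 2)) ((α × Fin 2) × (Fin n × Fin 2)) ℂ,
      Y * (Ψ' * Ψ'ᴴ) * Yᴴ = (Y * Ψ') * (Y * Ψ')ᴴ := fun Y => by
    rw [Matrix.conjTranspose_mul Y]
    simp only [Matrix.mul_assoc]
  rw [EqOnState, hconj, hconj, heq]
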